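/- Let $n\ge 1$ and let $\Omega\subset\mathbb{R}^n$ be bounded and open (for instance a bounded domain with Lipschitz, piecewise smooth boundary). Let $X=H^1_0(\Omega)$, the closure of $C_c^\infty(\Omega)$ in the norm $\|u\|_X^2=\|u\|_{L^2}^2+\|\nabla u\|_{L^2}^2$, and let $Y=H^{-1}(\Omega)$ be its dual with the dual norm, a Hilbert space through the Riesz isomorphism $Y\simeq X$; $L^2(\Omega)$ is embedded in $Y$ by $g\mapsto\big(\psi\mapsto\int_\Omega g\psi\big)$. Let $f:\mathbb{R}\to\mathbb{R}$ have a bounded, continuous derivative, and let $F:X\to Y$, $F(u)=-\Delta u-f(u)$, that is, $\langle F(u),\psi\rangle=\int_\Omega\nabla u\cdot\nabla\psi-\int_\Omega f(u)\,\psi$ for $\psi\in X$. Let $[\tilde a,\tilde b]$ be a closed interval with $-\infty\le\tilde a$ and $\tilde b<\infty$ (meaning $(-\infty,\tilde b]$ if $\tilde a=-\infty$) that contains $\overline{f'(\mathbb{R})}$; for example the smallest such interval. Label the eigenvalues of the Dirichlet Laplacian $-\Delta_D$ on $\Omega$ in non-decreasing order, with multiplicity, and let $J$ be the set of the indices of all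 eigenvalues in $[\tilde a,\tilde b]$. Let $V_X\subset X$ and $V_Y\subset Y$ be the spans, in $X$ and in $Y$, of the eigenfunctions with index in $J$, i.e. of all eigenfunctions whose eigenvalue lies in $[\tilde a,\tilde b]$. Let $W_X=V_X^\perp\subset X$ and $W_Y=V_Y^\perp\subset Y$, let $Q:Y\to W_Y$ be the orthogonal projection, and for $v\in V_X$ let $F_v:v+W_X\to W_Y$ be the restriction of $Q\circ F$ to $v+W_X$. Then each $F_v$ is Fréchet differentiable, and there is $C>0$ such that $$\|DF_v(w)h\|_Y\ \ge\ C\,\|h\|_X\qquad\text{for all } v\in V_X,\ w\in v+W_X,\ h\in W_X .$$ Moreover every derivative $DF_v(w):W_X\to W_Y$ is invertible (a bounded linear bijection with bounded inverse). -/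

import Mathlib

open MeasureTheory
open scoped ContDiff NNReal

noncomputable section

namespace Semilinear

/-- The Euclidean space `ℝⁿ`. -/
abbrev E (n : ℕ) : Type := EuclideanSpace ℝ (Fin n)

variable {n : ℕ}

/-- The Hilbert space `L²(Ω)` of real functions. -/
abbrev L2 (Ω : Set (E n)) : Type := Lp ℝ 2 (volume.restrict Ω)

/-- The Hilbert space `L²(Ω; ℝⁿ)` of vector fields. -/
abbrev L2Vec (Ω : Set (E n)) : Type := Lp (E n) 2 (volume.restrict Ω)

/-- `C_c^∞(Ω)`: smooth functions whose support is a compact subset of `Ω`. -/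
def IsTest (Ω : Set (E n)) (φ : E n → ℝ) : Prop :=
  ContDiff ℝ ∞ φ ∧ HasCompactSupport φ ∧ tsupport φ ⊆ Ω

/-- The pairs `(φ, ∇φ)`, `φ ∈ C_c^∞(Ω)`, in `L²(Ω) × L²(Ω; ℝⁿ)` with the Hilbert norm
`(‖u‖² + ‖g‖²)^{1/2}`. -/
def testGraph (Ω : Set (E n)) : Submodule ℝ (WithLp 2 (L2 Ω × L2Vec Ω)) where
  carrier := {p | ∃ φ : E n → ℝ, IsTest Ω φ ∧
    (p.fst : E n → ℝ) =ᵐ[volume.restrict Ω] φ ∧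
    (p.snd : E n → E n) =ᵐ[volume.restrict Ω] gradient φ}
  zero_mem' := by
    refine ⟨0, ⟨contDiff_const, HasCompactSupport.zero, by simp [tsupport]⟩, ?_, ?_⟩
    · exact Lp.coeFn_zero ℝ 2 (volume.restrict Ω)
    · have h : gradient (0 : E n → ℝ) = 0 := by
        funext x; simp [gradient]
      rw [h]
      exact Lp.coeFn_zero (E n) 2 (volume.restrict Ω)
  add_mem' := by
    rintro p q ⟨φ, ⟨hφ, hφc, hφΩ⟩, hp1, hp2⟩ ⟨ψ, ⟨hψ, hψc, hψΩ⟩, hq1, hq2⟩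
    refine ⟨φ + ψ, ⟨hφ.add hψ, hφc.add hψc,
      (tsupport_add φ ψ).trans (Set.union_subset hφΩ hψΩ)⟩, ?_, ?_⟩
    · exact (Lp.coeFn_add p.fst q.fst).trans (hp1.add hq1)
    · have h : gradient (φ + ψ) = gradient φ + gradient ψ := by
        funext x
        simp only [gradient, Pi.add_apply]
        rw [fderiv_add (hφ.differentiable (by simp) x) (hψ.differentiable (by simp) x), map_add]
      rw [h]
      exact (Lp.coeFn_add p.snd q.snd).trans (hp2.add hq2)
  smul_mem' := by
    rintro c p ⟨φ, ⟨hφ, hφc, hφΩ⟩, hp1, hp2⟩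
    refine ⟨c • φ, ⟨contDiff_const.smul hφ, hφc.smul_left (f := fun _ => c),
      (tsupport_smul_subset_right (fun _ => c) φ).trans hφΩ⟩, ?_, ?_⟩
    · exact (Lp.coeFn_smul c p.fst).trans (hp1.const_smul c)
    · have h : gradient (c • φ) = c • gradient φ := by
        funext x
        simp only [gradient, Pi.smul_apply]
        rw [fderiv_const_smul (hφ.differentiable (by simp) x), map_smul]
      rw [h]
      exact (Lp.coeFn_smul c p.snd).trans (hp2.const_smul c)

/-- The Sobolev space `H¹₀(Ω)`, the closure of `C_c^∞(Ω)` in the norm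
`‖u‖² = ‖u‖²_{L²} + ‖∇u‖²_{L²}`. An element is recorded as the pair `(u, ∇u)`, with `∇u` the weak
gradient of `u`; it is a Hilbert space with the inner product `∫ u v + ∫ ∇u · ∇v`. -/
def H10 (Ω : Set (E n)) : Type := (testGraph Ω).topologicalClosure

instance (Ω : Set (E n)) : NormedAddCommGroup (H10 Ω) :=
  inferInstanceAs (NormedAddCommGroup (testGraph Ω).topologicalClosure)

instance (Ω : Set (E n)) : InnerProductSpace ℝ (H10 Ω) :=
  inferInstanceAs (InnerProductSpace ℝ (testGraph Ω).topologicalClosure)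

instance (Ω : Set (E n)) : CompleteSpace (H10 Ω) :=
  inferInstanceAs (CompleteSpace (testGraph Ω).topologicalClosure)

/-- The pair `(u, ∇u)`, as a linear isometric map of `H¹₀(Ω)` into `L²(Ω) × L²(Ω; ℝⁿ)`. -/
def pair (Ω : Set (E n)) : H10 Ω →ₗᵢ[ℝ] WithLp 2 (L2 Ω × L2Vec Ω) :=
  (testGraph Ω).topologicalClosure.subtypeₗᵢ

/-- The function underlying an element of `H¹₀(Ω)`. -/
def val (Ω : Set (E n)) : H10 Ω →L[ℝ] L2 Ω :=
  (WithLp.fstL 2 ℝ (L2 Ω) (L2Vec Ω)).comp (pair Ω).toContinuousLinearMap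

/-- The weak gradient of an element of `H¹₀(Ω)`. -/
def grad (Ω : Set (E n)) : H10 Ω →L[ℝ] L2Vec Ω :=
  (WithLp.sndL 2 ℝ (L2 Ω) (L2Vec Ω)).comp (pair Ω).toContinuousLinearMap

/-- `H⁻¹(Ω)`, the dual of `H¹₀(Ω)` with the dual norm. -/
def Hm1 (Ω : Set (E n)) : Type := StrongDual ℝ (H10 Ω)

instance (Ω : Set (E n)) : NormedAddCommGroup (Hm1 Ω) :=
  inferInstanceAs (NormedAddCommGroup (StrongDual ℝ (H10 Ω)))

instance (Ω : Set (E n)) : NormedSpace ℝ (Hm1 Ω) :=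
  inferInstanceAs (NormedSpace ℝ (StrongDual ℝ (H10 Ω)))

instance (Ω : Set (E n)) : CompleteSpace (Hm1 Ω) :=
  inferInstanceAs (CompleteSpace (StrongDual ℝ (H10 Ω)))

instance (Ω : Set (E n)) : FunLike (Hm1 Ω) (H10 Ω) ℝ :=
  inferInstanceAs (FunLike (StrongDual ℝ (H10 Ω)) (H10 Ω) ℝ)

/-- The Riesz isomorphism `H¹₀(Ω) ≃ H⁻¹(Ω)`, `u ↦ (v ↦ ⟪u, v⟫)`, an isometry. -/
def riesz (Ω : Set (E n)) : H10 Ω ≃ₗᵢ[ℝ] Hm1 Ω := InnerProductSpace.toDual ℝ (H10 Ω)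

/-- The Hilbert structure of `H⁻¹(Ω) ≃ H¹₀(Ω)`: the dual norm comes from the inner product
transported by the Riesz isomorphism. -/
instance (Ω : Set (E n)) : InnerProductSpace ℝ (Hm1 Ω) where
  inner g k := inner ℝ ((riesz Ω).symm g) ((riesz Ω).symm k)
  norm_sq_eq_re_inner g := by
    rw [← InnerProductSpace.norm_sq_eq_re_inner, LinearIsometryEquiv.norm_map]
  conj_inner_symm g k := inner_conj_symm _ _
  add_left g k l := by rw [map_add, inner_add_left]
  smul_left g k r := by rw [map_smul, inner_smul_left]

/-- The inclusion `L²(Ω) → H⁻¹(Ω)`, `g ↦ (v ↦ ∫ g v)`. -/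
def embL2 (Ω : Set (E n)) : L2 Ω →ₗ[ℝ] Hm1 Ω where
  toFun g := ((innerSL ℝ g).comp (val Ω) : StrongDual ℝ (H10 Ω))
  map_add' g k := by
    change ((innerSL ℝ (g + k)).comp (val Ω) : StrongDual ℝ (H10 Ω)) =
      (innerSL ℝ g).comp (val Ω) + (innerSL ℝ k).comp (val Ω)
    rw [map_add, ContinuousLinearMap.add_comp]
  map_smul' c g := by
    change ((innerSL ℝ (c • g)).comp (val Ω) : StrongDual ℝ (H10 Ω)) =
      c • (innerSL ℝ g).comp (val Ω)
    ext v
    simp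

/-- The weak Dirichlet operator `-Δ : H¹₀(Ω) → H⁻¹(Ω)`, `u ↦ (v ↦ ∫ ∇u · ∇v)`. -/
def negLap (Ω : Set (E n)) (u : H10 Ω) : Hm1 Ω :=
  ((innerSL ℝ (grad Ω u)).comp (grad Ω) : StrongDual ℝ (H10 Ω))

/-- `φ` is an eigenfunction of the Dirichlet operator `-Δ` with eigenvalue `μ`:
`φ ≠ 0` and `-Δ φ = μ φ` in `H⁻¹(Ω)`. -/
def IsEigenfunction (Ω : Set (E n)) (μ : ℝ) (φ : H10 Ω) : Prop :=
  φ ≠ 0 ∧ negLap Ω φ = μ • embL2 Ω (val Ω φ)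

/-- The vertical subspace `V_X` of `H¹₀(Ω)`: the span of the eigenfunctions
whose eigenvalues belong to `I`. -/
def vertX (Ω : Set (E n)) (I : Set ℝ) : Submodule ℝ (H10 Ω) :=
  Submodule.span ℝ {φ | ∃ μ ∈ I, IsEigenfunction Ω μ φ}

/-- The vertical subspace `V_Y` of `H⁻¹(Ω)`: the span of the same eigenfunctions in `H⁻¹(Ω)`. -/
def vertY (Ω : Set (E n)) (I : Set ℝ) : Submodule ℝ (Hm1 Ω) :=
  Submodule.span ℝ {g | ∃ φ : H10 Ω, (∃ μ ∈ I, IsEigenfunction Ω μ φ) ∧ g = embL2 Ω (val Ω φ)}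

/-- The horizontal subspace `W_X = V_X^⊥` of `H¹₀(Ω)`. -/
abbrev horX (Ω : Set (E n)) (I : Set ℝ) : Submodule ℝ (H10 Ω) := (vertX Ω I)ᗮ

/-- The horizontal subspace `W_Y = V_Y^⊥` of `H⁻¹(Ω)`. -/
abbrev horY (Ω : Set (E n)) (I : Set ℝ) : Submodule ℝ (Hm1 Ω) := (vertY Ω I)ᗮ

/-- The nonlinearity: `f : ℝ → ℝ` has a bounded, continuous derivative. -/
structure IsNonlinearity (f : ℝ → ℝ) : Prop where
  contDiff : ContDiff ℝ 1 f
  bounded : ∃ M : ℝ, ∀ y, |deriv f y| ≤ M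

theorem IsNonlinearity.memLp {f : ℝ → ℝ} (hf : IsNonlinearity f) {Ω : Set (E n)}
    (hΩ : Bornology.IsBounded Ω) (u : L2 Ω) :
    MemLp (fun x => f (u x)) 2 (volume.restrict Ω) := by
  have : IsFiniteMeasure (volume.restrict Ω) :=
    isFiniteMeasure_restrict.mpr hΩ.measure_lt_top.ne
  obtain ⟨M, hM⟩ := hf.bounded
  have hlip : LipschitzWith M.toNNReal f := by
    refine lipschitzWith_of_nnnorm_deriv_le (hf.contDiff.differentiable (by simp)) fun y => ?_
    rw [← NNReal.coe_le_coe, coe_nnnorm, Real.norm_eq_abs]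
    exact (hM y).trans (Real.le_coe_toNNReal M)
  have hlip' : LipschitzWith M.toNNReal (fun y => f y - f 0) := by
    intro x y
    simpa [edist_dist, dist_eq_norm] using hlip x y
  have h1 : MemLp ((fun y => f y - f 0) ∘ (u : E n → ℝ)) 2 (volume.restrict Ω) :=
    hlip'.comp_memLp (by simp) (Lp.memLp u)
  have h2 := h1.add (memLp_const (f 0))
  refine h2.ae_eq (Filter.Eventually.of_forall fun x => ?_)
  simp

/-- The map `F : H¹₀(Ω) → H⁻¹(Ω)`, `F(u) = -Δ u - f(u)`, on a bounded `Ω`. -/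
def F {Ω : Set (E n)} (hΩ : Bornology.IsBounded Ω) {f : ℝ → ℝ} (hf : IsNonlinearity f)
    (u : H10 Ω) : Hm1 Ω :=
  negLap Ω u - embL2 Ω ((hf.memLp hΩ (val Ω u)).toLp)

/-- The projected restriction `F_v` of `Q F` to `v + W_X`, where `Q` is the orthogonal projection
of `H⁻¹(Ω)` onto `W_Y`; the point `v + w` of the affine subspace `v + W_X` is given by `w ∈ W_X`. -/
def projRestr {Ω : Set (E n)} (hΩ : Bornology.IsBounded Ω) {f : ℝ → ℝ} (hf : IsNonlinearity f)
    (I : Set ℝ) (v : H10 Ω) (w : horX Ω I) : horY Ω I :=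
  (horY Ω I).orthogonalProjectionOnto (F hΩ hf (v + w))

end Semilinear

end

/-! Under the Riesz isomorphism everything takes place in `H10 Ω`. With `ι = val Ω` and `T = ι* ι =
(1 - Δ)⁻¹` (`resolventOp`), `-Δ` becomes `1 - T`, and multiplication by `f'(u)` becomes `M = ι*
f'(u) ι` (`potentialOp`), which is symmetric with `a T ≤ M ≤ b T`. A Dirichlet eigenvalue `μ` is an
eigenvalue `l = 1 / (1 + μ)` of `T`, and the Riesz map carries `V_X` onto `V_Y`. Hence `DF_v(w)` is,
up to an isometry, the compression of `1 - T - M` to `W_X`.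

Split `x ∈ W_X` orthogonally as `p + q`, with `p` spectrally above `b` and `q` below `a`. The form
of `1 - T - M` is at least that of `1 - (1 + b) T` on `p` and at most that of `1 - (1 + a) T` on
`q`. Nonzero eigenvalues of a compact operator are isolated, so these two bounds are strictly
positive and strictly negative, uniformly. Pairing with the reflection `p - q` cancels the cross
terms of the symmetric `M` and leaves at least `c ‖x‖²` (`exists_uniform_reflected_coercive`). Since
`‖p - q‖ = ‖x‖`, Cauchy–Schwarz gives the estimate, with `c` depending only on `T`, `a`, `b`. A
symmetric operator bounded below is invertible.

Differentiability of `F` uses Rellich's theorem (`isCompactOperator_val`). Superposition by `f` on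
`L²` need not be Fréchet differentiable, but precomposed with a compact map it is
(`hasFDerivAt_superposition`). -/

open MeasureTheory
open scoped ContDiff NNReal

noncomputable section

namespace Semilinear

/-! ### Compact symmetric nonnegative operators on a Hilbert space -/

section Spectral

open Module Module.End

variable {H : Type*} [NormedAddCommGroup H] [InnerProductSpace ℝ H]

/-- The sum of the eigenspaces of `T` whose eigenvalue lies in `S`. -/
def eigenSum (T : H →L[ℝ] H) (S : Set ℝ) : Submodule ℝ H :=
  ⨆ l : S, eigenspace (T : End ℝ H) l

theorem eigenspace_le_eigenSum (T : H →L[ℝ] H) {S : Set ℝ} {l : ℝ} (hl : l ∈ S) :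
    eigenspace (T : End ℝ H) l ≤ eigenSum T S :=
  le_iSup (fun l : S => eigenspace (T : End ℝ H) l) ⟨l, hl⟩

theorem map_mem_eigenSum {T : H →L[ℝ] H} {S : Set ℝ} {x : H} (hx : x ∈ eigenSum T S) :
    T x ∈ eigenSum T S := by
  have h : eigenSum T S ≤ (eigenSum T S).comap (T : H →ₗ[ℝ] H) := by
    refine iSup_le fun l y hy => ?_
    have : T y = (l : ℝ) • y := mem_eigenspace_iff.mp hy
    change T y ∈ eigenSum T S
    rw [this]
    exact (eigenSum T S).smul_mem _ (eigenspace_le_eigenSum T l.2 hy)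
  exact h hx

theorem map_mem_closure_eigenSum {T : H →L[ℝ] H} {S : Set ℝ} {x : H}
    (hx : x ∈ (eigenSum T S).topologicalClosure) : T x ∈ (eigenSum T S).topologicalClosure :=
  map_mem_closure T.continuous hx fun _ hy => map_mem_eigenSum hy

theorem eigenSum_isOrtho {T : H →L[ℝ] H} (hs : (T : H →ₗ[ℝ] H).IsSymmetric) {S S' : Set ℝ}
    (h : ∀ l ∈ S, l ∈ S' → eigenspace (T : End ℝ H) l = ⊥) :
    eigenSum T S ⟂ eigenSum T S' := by
  refine Submodule.isOrtho_iSup_left.mpr fun l => Submodule.isOrtho_iSup_right.mpr fun l' => ?_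
  by_cases hll : (l : ℝ) = l'
  · rw [h l l.2 (hll ▸ l'.2)]
    exact Submodule.isOrtho_bot_left
  · exact hs.orthogonalFamily_eigenspaces.isOrtho hll

/-- Eigenspaces are orthogonal, so both quadratic forms are diagonal on finite sums of eigenvectors;
the inequality is closed and passes to the closure. -/
theorem inner_le_of_mem_eigenSum {T : H →L[ℝ] H} (hs : (T : H →ₗ[ℝ] H).IsSymmetric)
    {S : Set ℝ} {c d : ℝ}
    (h : ∀ l ∈ S, HasEigenvalue (T : End ℝ H) l → c ≤ d * l) {x : H}
    (hx : x ∈ (eigenSum T S).topologicalClosure) :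
    c * ‖x‖ ^ 2 ≤ d * inner ℝ (T x) x := by
  have hcl : IsClosed {x : H | c * ‖x‖ ^ 2 ≤ d * inner ℝ (T x) x} :=
    isClosed_le (by fun_prop) (by fun_prop)
  refine closure_minimal ?_ hcl hx
  intro y hy
  obtain ⟨g, hg, rfl⟩ := (Submodule.mem_iSup_iff_exists_finsupp _ _).mp hy
  let V : ∀ i : S, eigenspace (T : End ℝ H) i := fun i => ⟨g i, hg i⟩
  have hOF := hs.orthogonalFamily_eigenspaces.comp (Subtype.coe_injective (p := (· ∈ S)))
  have e1 : (g.sum fun _ xi => xi) =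
      ∑ i ∈ g.support, (eigenspace (T : End ℝ H) (i : ℝ)).subtypeₗᵢ (V i) := rfl
  have e2 : T (g.sum fun _ xi => xi) =
      ∑ i ∈ g.support, (eigenspace (T : End ℝ H) (i : ℝ)).subtypeₗᵢ ((i : ℝ) • V i) := by
    rw [e1, map_sum]
    refine Finset.sum_congr rfl fun i _ => ?_
    exact mem_eigenspace_iff.mp (V i).2
  have i1 : ‖g.sum fun _ xi => xi‖ ^ 2 = ∑ i ∈ g.support, ‖V i‖ ^ 2 := by
    rw [e1]; exact hOF.norm_sum V g.support
  have i2 : inner ℝ (T (g.sum fun _ xi => xi)) (g.sum fun _ xi => xi) =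
      ∑ i ∈ g.support, inner ℝ ((i : ℝ) • V i) (V i) := by
    rw [e2, e1]; exact hOF.inner_sum (fun i => (i : ℝ) • V i) V g.support
  change c * _ ≤ d * _
  rw [i1, i2, Finset.mul_sum, Finset.mul_sum]
  refine Finset.sum_le_sum fun i _ => ?_
  rw [real_inner_smul_left, real_inner_self_eq_norm_sq, ← mul_assoc]
  by_cases hV : V i = 0
  · simp [hV]
  · refine mul_le_mul_of_nonneg_right (h i i.2 ?_) (by positivity)
    exact hasEigenvalue_of_hasEigenvector (x := (V i : H)) ⟨(V i).2, by simpa using hV⟩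

theorem eigenvalue_nonneg {T : H →L[ℝ] H} (hp : ∀ x, 0 ≤ inner ℝ (T x) x) {l : ℝ}
    (hl : HasEigenvalue (T : End ℝ H) l) : 0 ≤ l := by
  obtain ⟨v, hv, hv0⟩ := hl.exists_hasEigenvector
  have h1 := hp v
  have h2 : T v = l • v := mem_eigenspace_iff.mp hv
  rw [h2, real_inner_smul_left, real_inner_self_eq_norm_sq] at h1
  exact nonneg_of_mul_nonneg_left h1 (by positivity)

variable [CompleteSpace H]

/-- A nonzero real number is isolated from the other eigenvalues of a compact symmetric
operator. -/
theorem exists_eigenvalue_gap {T : H →L[ℝ] H} (hT : IsCompactOperator T)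
    (hs : (T : H →ₗ[ℝ] H).IsSymmetric) {l₀ : ℝ} (h₀ : l₀ ≠ 0) :
    ∃ c > 0, ∀ l, l ≠ l₀ → HasEigenvalue (T : End ℝ H) l → c ≤ |l - l₀| := by
  have hinv := hs.invariant_orthogonalComplement_eigenspace l₀
  -- On this complement `l₀` is no longer an eigenvalue, so by the Fredholm alternative `S - l₀` is
  -- bounded below. Eigenvectors for every other `l` lie there, which bounds `|l - l₀|`.
  let S : (eigenspace (T : End ℝ H) l₀)ᗮ →L[ℝ] (eigenspace (T : End ℝ H) l₀)ᗮ :=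
    T.restrict hinv
  have hS : IsCompactOperator S := hT.restrict' hinv
  have hne : ¬ HasEigenvalue (S : End ℝ (eigenspace (T : End ℝ H) l₀)ᗮ) l₀ := by
    rw [hasEigenvalue_iff, not_not]
    exact eigenspace_restrict_eq_bot hinv (Submodule.orthogonal_disjoint _)
  obtain ⟨K, hK⟩ := hS.antilipschitz_of_not_hasEigenvalue h₀ hne
  obtain ⟨c, hc, hcS⟩ := antilipschitzWith_iff_exists_mul_le_norm.mp ⟨K, hK⟩
  refine ⟨c, hc, fun l hl hev => ?_⟩
  obtain ⟨v, hv, hv0⟩ := hev.exists_hasEigenvector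
  have hvK : v ∈ (eigenspace (T : End ℝ H) l₀)ᗮ :=
    (hs.orthogonalFamily_eigenspaces.isOrtho hl) hv
  have h1 := hcS ⟨v, hvK⟩
  have h2 : (S - l₀ • 1) ⟨v, hvK⟩ = (l - l₀) • (⟨v, hvK⟩ : (eigenspace (T : End ℝ H) l₀)ᗮ) := by
    apply Subtype.ext
    have : T v = l • v := mem_eigenspace_iff.mp hv
    simp [S, this, sub_smul]
  rw [h2, norm_smul, Real.norm_eq_abs] at h1
  exact le_of_mul_le_mul_right h1 (norm_pos_iff.mpr (by simpa using hv0))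

/-- The eigenvalues `l` of `T` for which `l⁻¹ - 1` lies in `[a, b]`. -/
def band (a b : ℝ) : Set ℝ := {l | 0 < l ∧ (1 + a) * l ≤ 1 ∧ 1 ≤ (1 + b) * l}

/-- The gap at `(1 + b)⁻¹` turns `(1 + b) * l < 1` into `1 - (1 + b) * l ≥ c * (1 + b)`. If `1 + b ≤
0`, nonnegativity of `T` suffices. -/
theorem exists_lower_bound_high {T : H →L[ℝ] H} (hT : IsCompactOperator T)
    (hs : (T : H →ₗ[ℝ] H).IsSymmetric) (hp : ∀ x, 0 ≤ inner ℝ (T x) x) (b : ℝ) :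
    ∃ c > 0, ∀ x ∈ (eigenSum T {l | (1 + b) * l < 1}).topologicalClosure,
      c * ‖x‖ ^ 2 ≤ ‖x‖ ^ 2 - (1 + b) * inner ℝ (T x) x := by
  rcases le_or_gt (1 + b) 0 with hb | hb
  · refine ⟨1, one_pos, fun x _ => ?_⟩
    nlinarith [hp x]
  · obtain ⟨c, hc, hgap⟩ := exists_eigenvalue_gap hT hs (inv_ne_zero hb.ne')
    refine ⟨c * (1 + b), by positivity, fun x hx => ?_⟩
    have := inner_le_of_mem_eigenSum hs (c := c * (1 + b) - 1) (d := -(1 + b)) (fun l hl hev => by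
      have hl' : l < (1 + b)⁻¹ := by
        rw [← one_div, lt_div_iff₀' hb]; exact hl
      have h1 := hgap l hl'.ne hev
      rw [abs_of_neg (by linarith)] at h1
      have h2 : (1 + b) * (1 + b)⁻¹ = 1 := mul_inv_cancel₀ hb.ne'
      nlinarith) hx
    linarith

theorem exists_lower_bound_low {T : H →L[ℝ] H} (hT : IsCompactOperator T)
    (hs : (T : H →ₗ[ℝ] H).IsSymmetric) (hp : ∀ x, 0 ≤ inner ℝ (T x) x) (a : ℝ) :
    ∃ c > 0, ∀ x ∈ (eigenSum T {l | 1 < (1 + a) * l}).topologicalClosure,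
      c * ‖x‖ ^ 2 ≤ (1 + a) * inner ℝ (T x) x - ‖x‖ ^ 2 := by
  rcases le_or_gt (1 + a) 0 with ha | ha
  -- No eigenvalue satisfies the condition here, since `l ≥ 0`; the eigenvalue hypothesis is vacuous
  -- and the constants are arbitrary.
  · refine ⟨1, one_pos, fun x hx => ?_⟩
    have := inner_le_of_mem_eigenSum hs (c := 2) (d := 1 + a) (fun l hl hev => by
      have h0 := eigenvalue_nonneg hp hev
      have h1 : 1 < (1 + a) * l := hl
      nlinarith) hx
    linarith
  · obtain ⟨c, hc, hgap⟩ := exists_eigenvalue_gap hT hs (inv_ne_zero ha.ne')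
    refine ⟨c * (1 + a), by positivity, fun x hx => ?_⟩
    have := inner_le_of_mem_eigenSum hs (c := c * (1 + a) + 1) (d := 1 + a) (fun l hl hev => by
      have hl' : (1 + a)⁻¹ < l := by
        rw [inv_lt_iff_one_lt_mul₀' ha]; exact hl
      have h1 := hgap l hl'.ne' hev
      rw [abs_of_pos (by linarith)] at h1
      have h2 : (1 + a) * (1 + a)⁻¹ = 1 := mul_inv_cancel₀ ha.ne'
      nlinarith) hx
    linarith

/-- The eigenspaces of a compact symmetric operator have dense span, and every eigenvalue is in the
band, above it or below it. What remains of `x` after the two projections is orthogonal to all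
eigenspaces, hence zero. -/
theorem exists_decomposition {T : H →L[ℝ] H} (hT : IsCompactOperator T)
    (hs : (T : H →ₗ[ℝ] H).IsSymmetric) (hp : ∀ x, 0 ≤ inner ℝ (T x) x) {a b : ℝ} (hab : a ≤ b)
    {x : H} (hx : x ∈ (eigenSum T (band a b))ᗮ) :
    ∃ p ∈ (eigenSum T {l | (1 + b) * l < 1}).topologicalClosure,
    ∃ q ∈ (eigenSum T {l | 1 < (1 + a) * l}).topologicalClosure,
      p ∈ (eigenSum T (band a b))ᗮ ∧ q ∈ (eigenSum T (band a b))ᗮ ∧ x = p + q ∧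
      inner ℝ p q = 0 ∧ inner ℝ (T p) q = 0 := by
  set V := eigenSum T (band a b)
  set P := eigenSum T {l | (1 + b) * l < 1}
  set N := eigenSum T {l | 1 < (1 + a) * l}
  have hbot : ∀ l, ¬ 0 ≤ l → eigenspace (T : End ℝ H) l = ⊥ := fun l hl => by
    by_contra h
    exact hl (eigenvalue_nonneg hp h)
  have hPV : P ⟂ V := eigenSum_isOrtho hs fun l hl hl' => absurd hl'.2.2 (not_le.mpr hl)
  have hNV : N ⟂ V := eigenSum_isOrtho hs fun l hl hl' => absurd hl'.2.1 (not_le.mpr hl)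
  have hPN : P ⟂ N := eigenSum_isOrtho hs fun l hl hl' => hbot l fun h0 => by
    have h1 : (1 + b) * l < 1 := hl
    have h2 : 1 < (1 + a) * l := hl'
    nlinarith
  have hPcl : P.topologicalClosure ≤ Vᗮ :=
    Submodule.topologicalClosure_minimal _ hPV V.isClosed_orthogonal
  have hNcl : N.topologicalClosure ≤ Vᗮ :=
    Submodule.topologicalClosure_minimal _ hNV V.isClosed_orthogonal
  have hPNcl : P.topologicalClosure ⟂ N.topologicalClosure := by
    have h1 : P.topologicalClosure ⟂ N :=
      Submodule.topologicalClosure_minimal _ hPN N.isClosed_orthogonal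
    have h2 : N.topologicalClosure ⟂ P.topologicalClosure :=
      Submodule.topologicalClosure_minimal _ h1.symm P.topologicalClosure.isClosed_orthogonal
    exact h2.symm
  have : CompleteSpace P.topologicalClosure := P.isClosed_topologicalClosure.completeSpace_coe
  have : CompleteSpace N.topologicalClosure := N.isClosed_topologicalClosure.completeSpace_coe
  set p : H := P.topologicalClosure.starProjection x
  set q : H := N.topologicalClosure.starProjection x
  have hpm : p ∈ P.topologicalClosure := Submodule.starProjection_apply_mem _ _
  have hqm : q ∈ N.topologicalClosure := Submodule.starProjection_apply_mem _ _
  have hr : x - p - q = 0 := by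
    have hall : ∀ l, eigenspace (T : End ℝ H) l ≤ (Submodule.span ℝ {x - p - q})ᗮ := by
      intro l y hy
      rw [Submodule.mem_orthogonal_singleton_iff_inner_left]
      by_cases h0 : 0 ≤ l
      -- The value `l = 0` falls in this case, so injectivity of `T` is not needed.
      · by_cases hlb : (1 + b) * l < 1
        · have hyP : y ∈ P.topologicalClosure :=
            P.le_topologicalClosure (eigenspace_le_eigenSum T (S := {l | (1 + b) * l < 1}) hlb hy)
          rw [inner_sub_right, hPNcl.inner_eq hyP hqm, sub_zero]
          exact Submodule.sub_starProjection_mem_orthogonal x y hyP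
        · by_cases hla : 1 < (1 + a) * l
          · have hyN : y ∈ N.topologicalClosure :=
              N.le_topologicalClosure (eigenspace_le_eigenSum T (S := {l | 1 < (1 + a) * l}) hla hy)
            rw [sub_right_comm, inner_sub_right, hPNcl.symm.inner_eq hyN hpm, sub_zero]
            exact Submodule.sub_starProjection_mem_orthogonal x y hyN
          · have hyV : y ∈ V := by
              refine eigenspace_le_eigenSum T (S := band a b) ⟨?_, not_lt.mp hla, not_lt.mp hlb⟩ hy
              rcases h0.eq_or_lt with h | h
              · rw [← h] at hlb; norm_num at hlb
              · exact h
            exact (Vᗮ.sub_mem (Vᗮ.sub_mem hx (hPcl hpm)) (hNcl hqm)) y hyV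
      · rw [hbot l h0, Submodule.mem_bot] at hy
        simp [hy]
    have h1 : x - p - q ∈ (⨆ l, eigenspace (T : End ℝ H) l)ᗮ := by
      refine Submodule.orthogonal_le (iSup_le hall) ?_
      exact Submodule.le_orthogonal_orthogonal _ (Submodule.mem_span_singleton_self _)
    rwa [ContinuousLinearMap.orthogonalComplement_iSup_eigenspaces_eq_bot hT hs,
      Submodule.mem_bot] at h1
  refine ⟨p, hpm, q, hqm, hPcl hpm, hNcl hqm, ?_, hPNcl.inner_eq hpm hqm,
    hPNcl.inner_eq (map_mem_closure_eigenSum hpm) hqm⟩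
  rw [sub_sub, sub_eq_zero] at hr
  exact hr

/-- The form of `1 - T - M` is bounded below, up to a reflection, on the orthogonal complement
of the eigenspaces of `T` in the band of `[a, b]`, when `a T ≤ M ≤ b T`. -/
theorem exists_uniform_reflected_coercive {T : H →L[ℝ] H} (hT : IsCompactOperator T)
    (hs : (T : H →ₗ[ℝ] H).IsSymmetric) (hp : ∀ x, 0 ≤ inner ℝ (T x) x) {a b : ℝ} (hab : a ≤ b) :
    ∃ c > 0, ∀ x ∈ (eigenSum T (band a b))ᗮ, ∃ y ∈ (eigenSum T (band a b))ᗮ, ‖y‖ = ‖x‖ ∧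
      ∀ M : H →L[ℝ] H, (M : H →ₗ[ℝ] H).IsSymmetric →
        (∀ z, a * inner ℝ (T z) z ≤ inner ℝ (M z) z) →
        (∀ z, inner ℝ (M z) z ≤ b * inner ℝ (T z) z) →
        c * ‖x‖ ^ 2 ≤ inner ℝ (x - T x - M x) y := by
  obtain ⟨c₁, hc₁, h₁⟩ := exists_lower_bound_high hT hs hp b
  obtain ⟨c₂, hc₂, h₂⟩ := exists_lower_bound_low hT hs hp a
  refine ⟨min c₁ c₂, lt_min hc₁ hc₂, fun x hx => ?_⟩
  obtain ⟨p, hpm, q, hqm, hpV, hqV, rfl, hpq, hTpq⟩ := exists_decomposition hT hs hp hab hx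
  have hqp : inner ℝ q p = 0 := by rw [real_inner_comm]; exact hpq
  have n1 : ‖p + q‖ ^ 2 = ‖p‖ ^ 2 + ‖q‖ ^ 2 := by rw [norm_add_sq_real, hpq]; ring
  have n2 : ‖p - q‖ ^ 2 = ‖p‖ ^ 2 + ‖q‖ ^ 2 := by rw [norm_sub_sq_real, hpq]; ring
  refine ⟨p - q, Submodule.sub_mem _ hpV hqV, ?_, fun M hM hMa hMb => ?_⟩
  · rw [← sq_eq_sq₀ (norm_nonneg _) (norm_nonneg _), n1, n2]
  have hTqp : inner ℝ (T q) p = 0 := by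
    rw [← hTpq, real_inner_comm]; exact (hs p q).symm
  have hMqp : inner ℝ (M q) p = inner ℝ (M p) q := by
    rw [real_inner_comm]; exact (hM p q).symm
  have key : inner ℝ (p + q - T (p + q) - M (p + q)) (p - q) =
      ‖p‖ ^ 2 - ‖q‖ ^ 2 - inner ℝ (T p) p + inner ℝ (T q) q - inner ℝ (M p) p
        + inner ℝ (M q) q := by
    simp only [map_add, inner_add_left, inner_sub_left, inner_sub_right, hTqp, hTpq, hpq, hqp,
      hMqp, real_inner_self_eq_norm_sq]
    ring
  rw [key, n1]
  have e1 := h₁ p hpm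
  have e2 := h₂ q hqm
  have e3 : min c₁ c₂ * ‖p‖ ^ 2 ≤ c₁ * ‖p‖ ^ 2 := by gcongr; exact min_le_left _ _
  have e4 : min c₁ c₂ * ‖q‖ ^ 2 ≤ c₂ * ‖q‖ ^ 2 := by gcongr; exact min_le_right _ _
  linarith [hMa q, hMb p]

/-- The lower bound gives injectivity and closed range; by symmetry the orthogonal complement of the
range is the kernel. -/
theorem isInvertible_of_symmetric_of_bound {A : H →L[ℝ] H} (hA : (A : H →ₗ[ℝ] H).IsSymmetric)
    {c : ℝ} (hc : 0 < c) (h : ∀ x, c * ‖x‖ ≤ ‖A x‖) : A.IsInvertible := by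
  have hanti : AntilipschitzWith (Real.toNNReal c)⁻¹ A := by
    refine A.antilipschitz_of_bound fun x => ?_
    rw [NNReal.coe_inv, Real.coe_toNNReal c hc.le, inv_mul_eq_div, le_div_iff₀' hc]
    exact h x
  have hker : A.ker = ⊥ := LinearMap.ker_eq_bot.mpr hanti.injective
  have hclosed : IsClosed (A.range : Set H) := by
    rw [LinearMap.coe_range]
    exact hanti.isClosed_range A.uniformContinuous
  have : CompleteSpace A.range := hclosed.completeSpace_coe
  have hrange : A.range = ⊤ := by
    rw [← Submodule.orthogonal_eq_bot_iff, Submodule.eq_bot_iff]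
    intro x hx
    have h1 : inner ℝ (A (A x)) x = 0 := hx _ ⟨A x, rfl⟩
    have h2 : inner ℝ (A x) (A x) = 0 := by
      rw [← h1]; exact (hA (A x) x).symm
    exact hanti.injective ((inner_self_eq_zero.mp h2).trans (map_zero A).symm)
  exact ⟨ContinuousLinearEquiv.ofBijective A hker hrange, by ext; rfl⟩

end Spectral

/-! ### Differentiability of superposition operators -/

section Superposition

open Filter Topology

variable {α : Type*} [MeasurableSpace α] {μ : Measure α}

/-- Dominated convergence, with majorant `B ^ 2 * g ^ 2`. The function `g` must be fixed:
multiplication by `θ k` need not tend to zero in operator norm. -/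
theorem tendsto_norm_of_ae_eq_mul {θ : ℕ → α → ℝ} {B : ℝ}
    (hθm : ∀ k, AEStronglyMeasurable (θ k) μ) (hθB : ∀ k x, |θ k x| ≤ B)
    (hθ : ∀ᵐ x ∂μ, Tendsto (fun k => θ k x) atTop (𝓝 0)) (g : Lp ℝ 2 μ) (s : ℕ → Lp ℝ 2 μ)
    (hs : ∀ k, s k =ᵐ[μ] fun x => θ k x * g x) :
    Tendsto (fun k => ‖s k‖) atTop (𝓝 0) := by
  have hsq : ∀ k, ‖s k‖ ^ 2 = ∫ x, (θ k x) ^ 2 * (g x) ^ 2 ∂μ := fun k => by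
    rw [← real_inner_self_eq_norm_sq, L2.inner_def]
    refine integral_congr_ae ?_
    filter_upwards [hs k] with x hx
    rw [hx, real_inner_self_eq_norm_sq, Real.norm_eq_abs, sq_abs, mul_pow]
  have hg : Integrable (fun x => (g x) ^ 2) μ := (Lp.memLp g).integrable_sq
  have hlim : Tendsto (fun k => ∫ x, (θ k x) ^ 2 * (g x) ^ 2 ∂μ) atTop (𝓝 (∫ _, (0 : ℝ) ∂μ)) := by
    refine tendsto_integral_of_dominated_convergence (fun x => B ^ 2 * (g x) ^ 2)
      (fun k => ((hθm k).pow 2).mul hg.aestronglyMeasurable) (hg.const_mul _) ?_ ?_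
    · refine fun k => Eventually.of_forall fun x => ?_
      rw [Real.norm_eq_abs, abs_of_nonneg (by positivity)]
      exact mul_le_mul_of_nonneg_right (sq_le_sq.mpr ((hθB k x).trans (le_abs_self B)))
        (sq_nonneg _)
    · filter_upwards [hθ] with x hx
      simpa using (hx.pow 2).mul_const ((g x) ^ 2)
  simp only [← hsq, integral_zero] at hlim
  have := hlim.sqrt
  simpa using this

/-- If the linear map `ι` into `L²` is compact and `f` has a bounded derivative, then the
superposition operator `u ↦ f (ι u)` is Fréchet differentiable. -/
theorem hasFDerivAt_superposition {X : Type*} [NormedAddCommGroup X] [NormedSpace ℝ X]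
    {ι : X →L[ℝ] Lp ℝ 2 μ} (hι : IsCompactOperator ι) {f : ℝ → ℝ} (hf : ContDiff ℝ 1 f) {M : ℝ}
    (hM : ∀ y, |deriv f y| ≤ M) {N : X → Lp ℝ 2 μ}
    (hN : ∀ u, N u =ᵐ[μ] fun x => f (ι u x)) (u : X) {D : X →L[ℝ] Lp ℝ 2 μ}
    (hD : ∀ h, D h =ᵐ[μ] fun x => deriv f (ι u x) * ι h x) : HasFDerivAt N D u := by
  have hdiff : Differentiable ℝ f := hf.differentiable (by simp)
  have hlip : ∀ s t, |f (s + t) - f s| ≤ M * |t| := fun s t => by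
    have := Convex.norm_image_sub_le_of_norm_deriv_le (f := f) (s := Set.univ) (C := M)
      (fun x _ => hdiff x) (fun x _ => hM x) convex_univ (Set.mem_univ s) (Set.mem_univ (s + t))
    simpa using this
  have hM0 : 0 ≤ M := (abs_nonneg _).trans (hM 0)
  -- The relative Taylor remainder. Division by zero gives `q s 0 = 0`, so it is bounded by `2 * M`
  -- and tends to `0` as `t → 0`, with `t = 0` included.
  set q : ℝ → ℝ → ℝ := fun s t => (f (s + t) - f s - deriv f s * t) / t with hq
  have hqmul : ∀ s t, q s t * t = f (s + t) - f s - deriv f s * t := fun s t => by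
    by_cases ht : t = 0
    · simp [ht]
    · simp [hq, ht]
  have hqB : ∀ s t, |q s t| ≤ 2 * M := fun s t => by
    rw [hq, abs_div]
    refine div_le_of_le_mul₀ (abs_nonneg _) (by positivity) ?_
    calc |f (s + t) - f s - deriv f s * t| ≤ |f (s + t) - f s| + |deriv f s * t| := abs_sub _ _
      _ ≤ M * |t| + M * |t| := by
        rw [abs_mul]
        exact add_le_add (hlip s t) (mul_le_mul_of_nonneg_right (hM s) (abs_nonneg t))
      _ = 2 * M * |t| := by ring
  have hq0 : ∀ s, Tendsto (q s) (𝓝 0) (𝓝 0) := fun s => by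
    rw [Metric.tendsto_nhds]
    intro ε hε
    have h1 := (hasDerivAt_iff_isLittleO_nhds_zero.mp (hdiff s).hasDerivAt).def (half_pos hε)
    filter_upwards [h1] with t ht
    rw [dist_zero_right, hq, norm_div]
    refine (div_le_of_le_mul₀ (norm_nonneg _) (by positivity) ?_).trans_lt (half_lt_self hε)
    simpa [mul_comm] using ht
  rw [hasFDerivAt_iff_tendsto]
  refine tendsto_of_seq_tendsto fun y hy => tendsto_of_subseq_tendsto fun ns hns => ?_
  have hyn : Tendsto (fun k => y (ns k)) atTop (𝓝 u) := hy.comp hns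
  set z : ℕ → X := fun k => y (ns k) - u with hz
  have hz0 : Tendsto z atTop (𝓝 0) := by simpa using hyn.sub_const u
  -- Compactness of `ι` enters here: along a subsequence the images of the normalized increments
  -- converge to one fixed `g` in `L²`. A further subsequence makes the increments themselves tend
  -- to zero almost everywhere.
  have hcpt := hι.isCompact_closure_image_closedBall (1 : ℝ)
  obtain ⟨g, -, φ, hφ, hg⟩ := hcpt.tendsto_subseq (x := fun k => ι (‖z k‖⁻¹ • z k)) fun k => by
    refine subset_closure ⟨_, ?_, rfl⟩
    rw [mem_closedBall_zero_iff, norm_smul, norm_inv, norm_norm]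
    exact inv_mul_le_one
  have hL : Tendsto (fun k => ι (z (φ k))) atTop (𝓝 (0 : Lp ℝ 2 μ)) := by
    have := (ι.continuous.tendsto 0).comp (hz0.comp hφ.tendsto_atTop)
    rwa [map_zero] at this
  obtain ⟨ψ, hψ, hae⟩ := (tendstoInMeasure_of_tendsto_Lp hL).exists_seq_tendsto_ae
  set m : ℕ → ℕ := fun k => φ (ψ k)
  refine ⟨m, ?_⟩
  set θ : ℕ → α → ℝ := fun k x => q (ι u x) (ι (z (m k)) x)
  have hcont : Continuous (deriv f) := hf.continuous_deriv (by simp)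
  have hθm : ∀ k, AEStronglyMeasurable (θ k) μ := fun k => by
    have a1 : AEMeasurable (ι u : α → ℝ) μ := (Lp.aestronglyMeasurable _).aemeasurable
    have a2 : AEMeasurable (ι (z (m k)) : α → ℝ) μ := (Lp.aestronglyMeasurable _).aemeasurable
    refine AEMeasurable.aestronglyMeasurable ?_
    exact (((hf.continuous.measurable.comp_aemeasurable (a1.add a2)).sub
      (hf.continuous.measurable.comp_aemeasurable a1)).sub
      ((hcont.measurable.comp_aemeasurable a1).mul a2)).div a2
  have hθg : ∀ k, MemLp (fun x => θ k x * g x) 2 μ := fun k => by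
    refine MemLp.of_le_mul (c := 2 * M) (Lp.memLp g)
      ((hθm k).mul (Lp.aestronglyMeasurable g)) (Eventually.of_forall fun x => ?_)
    rw [norm_mul]
    exact mul_le_mul_of_nonneg_right (hqB _ _) (norm_nonneg _)
  have hs0 := tendsto_norm_of_ae_eq_mul hθm (fun k x => hqB _ _) (by
    filter_upwards [hae, Lp.coeFn_zero ℝ 2 μ] with x hx hx0
    rw [hx0] at hx
    exact (hq0 (ι u x)).comp hx) g (fun k => (hθg k).toLp) (fun k => (hθg k).coeFn_toLp)
  have he0 : Tendsto (fun k => 2 * M * ‖ι (‖z (m k)‖⁻¹ • z (m k)) - g‖) atTop (𝓝 0) := by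
    have := (tendsto_iff_norm_sub_tendsto_zero.mp (hg.comp hψ.tendsto_atTop)).const_mul (2 * M)
    simpa using this
  have hsum := he0.add hs0
  rw [add_zero] at hsum
  refine squeeze_zero (fun k => mul_nonneg (inv_nonneg.mpr (norm_nonneg _)) (norm_nonneg _))
    (fun k => ?_) hsum
  set e := ι (‖z (m k)‖⁻¹ • z (m k))
  set R := N (y (ns (m k))) - N u - D (y (ns (m k)) - u) with hR
  have hRae : ‖z (m k)‖⁻¹ • R =ᵐ[μ] fun x => θ k x * e x := by
    have hyk : y (ns (m k)) = u + z (m k) := by simp [hz]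
    have h1 : e = ‖z (m k)‖⁻¹ • ι (z (m k)) := map_smul _ _ _
    have h2 : ι (y (ns (m k))) = ι u + ι (z (m k)) := by rw [hyk, map_add]
    filter_upwards [Lp.coeFn_smul ‖z (m k)‖⁻¹ R, Lp.coeFn_smul ‖z (m k)‖⁻¹ (ι (z (m k))),
      Lp.coeFn_sub (N (y (ns (m k))) - N u) (D (z (m k))), Lp.coeFn_sub (N (y (ns (m k)))) (N u),
      hN (y (ns (m k))), hN u, hD (z (m k)), Lp.coeFn_add (ι u) (ι (z (m k)))]
      with x x1 x2 x3 x4 x5 x6 x7 x8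
    have hRx : R x = f (ι u x + ι (z (m k)) x) - f (ι u x) -
        deriv f (ι u x) * ι (z (m k)) x := by
      rw [hR]
      change (N (y (ns (m k))) - N u - D (z (m k)) : Lp ℝ 2 μ) x = _
      rw [x3, Pi.sub_apply, x4, Pi.sub_apply, x5, x6, x7, h2, x8, Pi.add_apply]
    rw [x1, h1, x2, Pi.smul_apply, Pi.smul_apply, hRx, ← hqmul]
    simp only [smul_eq_mul, θ]
    ring
  -- The uniform bound on `q` allows the direction `e`, which varies with `k`, to be replaced by its
  -- limit `g`.
  have hdiff' : ‖‖z (m k)‖⁻¹ • R - (hθg k).toLp‖ ≤ 2 * M * ‖e - g‖ := by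
    refine Lp.norm_le_mul_norm_of_ae_le_mul ?_
    filter_upwards [hRae, Lp.coeFn_sub (‖z (m k)‖⁻¹ • R) (hθg k).toLp, (hθg k).coeFn_toLp,
      Lp.coeFn_sub e g] with x x1 x2 x3 x4
    rw [x2, x4, Pi.sub_apply, Pi.sub_apply, x1, x3, ← mul_sub, norm_mul]
    exact mul_le_mul_of_nonneg_right (hqB _ _) (norm_nonneg _)
  calc ‖y (ns (m k)) - u‖⁻¹ * ‖R‖ = ‖‖z (m k)‖⁻¹ • R‖ := by
        rw [norm_smul, norm_inv, norm_norm]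
    _ = ‖(‖z (m k)‖⁻¹ • R - (hθg k).toLp) + (hθg k).toLp‖ := by rw [sub_add_cancel]
    _ ≤ _ := (norm_add_le _ _).trans (add_le_add_left hdiff' _)

/-! ### Multiplication operators on `L²` -/

theorem memLp_bounded_mul {g : α → ℝ} (hg : AEStronglyMeasurable g μ) {M : ℝ}
    (hM : ∀ x, |g x| ≤ M) (u : Lp ℝ 2 μ) : MemLp (fun x => g x * u x) 2 μ :=
  MemLp.of_le_mul (c := M) (Lp.memLp u) (hg.mul (Lp.aestronglyMeasurable u))
    (Eventually.of_forall fun x => by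
      rw [norm_mul]
      exact mul_le_mul_of_nonneg_right (hM x) (norm_nonneg _))

/-- Multiplication by a bounded function, as a linear map on `L²`. -/
def mulLin (g : α → ℝ) (hg : AEStronglyMeasurable g μ) (M : ℝ) (hM : ∀ x, |g x| ≤ M) :
    Lp ℝ 2 μ →ₗ[ℝ] Lp ℝ 2 μ where
  toFun u := MemLp.toLp (fun x => g x * u x) (memLp_bounded_mul hg hM u)
  map_add' u v := by
    have h := memLp_bounded_mul hg hM
    refine Lp.ext ?_
    filter_upwards [(h (u + v)).coeFn_toLp, (h u).coeFn_toLp, (h v).coeFn_toLp,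
      Lp.coeFn_add u v, Lp.coeFn_add (h u).toLp (h v).toLp] with x x1 x2 x3 x4 x5
    rw [x1, x5, Pi.add_apply, x2, x3, x4, Pi.add_apply, mul_add]
  map_smul' c u := by
    have h := memLp_bounded_mul hg hM
    refine Lp.ext ?_
    filter_upwards [(h (c • u)).coeFn_toLp, (h u).coeFn_toLp, Lp.coeFn_smul c u,
      Lp.coeFn_smul c (h u).toLp] with x x1 x2 x3 x4
    rw [RingHom.id_apply, x1, x4, Pi.smul_apply, x2, x3, Pi.smul_apply, smul_eq_mul,
      smul_eq_mul, mul_left_comm]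

/-- Multiplication by a bounded function, as an operator on `L²`. -/
def mulOp (g : α → ℝ) (hg : AEStronglyMeasurable g μ) (M : ℝ) (hM : ∀ x, |g x| ≤ M) :
    Lp ℝ 2 μ →L[ℝ] Lp ℝ 2 μ :=
  (mulLin g hg M hM).mkContinuous M fun u => by
    refine Lp.norm_le_mul_norm_of_ae_le_mul ?_
    filter_upwards [(memLp_bounded_mul hg hM u).coeFn_toLp] with x hx
    change ‖(memLp_bounded_mul hg hM u).toLp _ x‖ ≤ _
    rw [hx, norm_mul]
    exact mul_le_mul_of_nonneg_right (hM x) (norm_nonneg _)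

theorem mulOp_ae {g : α → ℝ} {hg : AEStronglyMeasurable g μ} {M : ℝ} {hM : ∀ x, |g x| ≤ M}
    (u : Lp ℝ 2 μ) : mulOp g hg M hM u =ᵐ[μ] fun x => g x * u x :=
  MemLp.coeFn_toLp (memLp_bounded_mul hg hM u)

theorem inner_mulOp {g : α → ℝ} {hg : AEStronglyMeasurable g μ} {M : ℝ} {hM : ∀ x, |g x| ≤ M}
    (u v : Lp ℝ 2 μ) : inner ℝ (mulOp g hg M hM u) v = ∫ x, g x * (u x * v x) ∂μ := by
  rw [L2.inner_def]
  refine integral_congr_ae ?_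
  filter_upwards [mulOp_ae (hg := hg) (hM := hM) u] with x hx
  rw [hx, RCLike.inner_apply, conj_trivial]
  ring

theorem inner_mulOp_comm {g : α → ℝ} {hg : AEStronglyMeasurable g μ} {M : ℝ}
    {hM : ∀ x, |g x| ≤ M} (u v : Lp ℝ 2 μ) :
    inner ℝ (mulOp g hg M hM u) v = inner ℝ u (mulOp g hg M hM v) := by
  rw [← real_inner_comm u, inner_mulOp, inner_mulOp]
  simp only [mul_comm]

theorem integrable_mulOp {g : α → ℝ} (hg : AEStronglyMeasurable g μ) {M : ℝ}
    (hM : ∀ x, |g x| ≤ M) (u : Lp ℝ 2 μ) : Integrable (fun x => g x * (u x * u x)) μ := by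
  have h : Integrable (fun x => u x * u x) μ := by
    simpa [sq] using (Lp.memLp u).integrable_sq
  exact h.bdd_mul hg (Eventually.of_forall hM)

theorem norm_sq_eq_integral (u : Lp ℝ 2 μ) : ‖u‖ ^ 2 = ∫ x, u x * u x ∂μ := by
  rw [← real_inner_self_eq_norm_sq, L2.inner_def]
  rfl

theorem inner_mulOp_le {g : α → ℝ} {hg : AEStronglyMeasurable g μ} {M : ℝ} {hM : ∀ x, |g x| ≤ M}
    {b : ℝ} (hb : ∀ x, g x ≤ b) (u : Lp ℝ 2 μ) :
    inner ℝ (mulOp g hg M hM u) u ≤ b * ‖u‖ ^ 2 := by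
  rw [inner_mulOp, norm_sq_eq_integral, ← integral_const_mul]
  refine integral_mono (integrable_mulOp hg hM u) (Integrable.const_mul ?_ b) fun x =>
    mul_le_mul_of_nonneg_right (hb x) (mul_self_nonneg _)
  simpa [sq] using (Lp.memLp u).integrable_sq

theorem le_inner_mulOp {g : α → ℝ} {hg : AEStronglyMeasurable g μ} {M : ℝ} {hM : ∀ x, |g x| ≤ M}
    {a : ℝ} (ha : ∀ x, a ≤ g x) (u : Lp ℝ 2 μ) :
    a * ‖u‖ ^ 2 ≤ inner ℝ (mulOp g hg M hM u) u := by
  rw [inner_mulOp, norm_sq_eq_integral, ← integral_const_mul]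
  refine integral_mono (Integrable.const_mul ?_ a) (integrable_mulOp hg hM u) fun x =>
    mul_le_mul_of_nonneg_right (ha x) (mul_self_nonneg _)
  simpa [sq] using (Lp.memLp u).integrable_sq

end Superposition

/-! ### Rellich's theorem, by averaging over small cubes -/

/-- A continuous linear map is compact if it is controlled, up to an arbitrarily small multiple of
the norm, by finitely many continuous functionals. -/
theorem isCompactOperator_of_le_add_sum {X Y : Type*} [NormedAddCommGroup X] [NormedSpace ℝ X]
    [NormedAddCommGroup Y] [NormedSpace ℝ Y] [CompleteSpace Y] {κ : Type*} (A : X →L[ℝ] Y)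
    (h : ∀ δ > 0, ∃ (K : Finset κ) (ℓ : κ → X →L[ℝ] ℝ) (c : ℝ), 0 ≤ c ∧
      ∀ u, ‖A u‖ ^ 2 ≤ δ * ‖u‖ ^ 2 + c * ∑ k ∈ K, (ℓ k u) ^ 2) : IsCompactOperator A := by
  refine (isCompactOperator_iff_isCompact_closure_image_closedBall
    (A : X →ₗ[ℝ] Y) one_pos).mpr ?_
  refine TotallyBounded.isCompact_of_isClosed (TotallyBounded.closure ?_) isClosed_closure
  rw [Metric.totallyBounded_iff]
  intro ε hε
  -- Two points of the unit ball have squared distance at most `4`, so `ε ^ 2 / 8` contributes at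
  -- most half of `ε ^ 2`. The other half comes from a finite net for the values of the functionals
  -- in `K`.
  obtain ⟨K, ℓ, c, hc, hA⟩ := h (ε ^ 2 / 8) (by positivity)
  let P : X →L[ℝ] (K → ℝ) := ContinuousLinearMap.pi fun k => ℓ k
  have hP : TotallyBounded (P '' Metric.closedBall 0 1) :=
    (P.lipschitz.isBounded_image Metric.isBounded_closedBall).isCompact_closure
      |>.totallyBounded.subset subset_closure
  obtain ⟨η, hη, hηc⟩ : ∃ η > 0, c * (K.card * η ^ 2) < ε ^ 2 / 2 := by
    have hcont : Filter.Tendsto (fun η : ℝ => c * (K.card * η ^ 2)) (nhdsWithin 0 (Set.Ioi 0))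
        (nhds 0) := by
      have : Continuous (fun η : ℝ => c * (K.card * η ^ 2)) := by fun_prop
      exact (this.tendsto' 0 0 (by simp)).mono_left nhdsWithin_le_nhds
    have := (hcont.eventually_lt_const (by positivity : 0 < ε ^ 2 / 2)).and self_mem_nhdsWithin
    obtain ⟨η, h1, h2⟩ := this.exists
    exact ⟨η, h2, h1⟩
  obtain ⟨s, hsub, hsf, ht⟩ := Set.exists_subset_image_finite_and.mp
    (hP.exists_subset (Metric.dist_mem_uniformity hη))
  refine ⟨A '' s, hsf.image A, ?_⟩
  rintro _ ⟨u, hu, rfl⟩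
  obtain ⟨_, ⟨v, hv, rfl⟩, hd⟩ := Set.mem_iUnion₂.mp (ht ⟨u, hu, rfl⟩)
  refine Set.mem_iUnion₂.mpr ⟨A v, ⟨v, hv, rfl⟩, ?_⟩
  have hd' : dist (P u) (P v) < η := hd
  have hu1 : ‖u‖ ≤ 1 := mem_closedBall_zero_iff.mp hu
  have hv1 : ‖v‖ ≤ 1 := mem_closedBall_zero_iff.mp (hsub hv)
  have h1 : ‖u - v‖ ^ 2 ≤ 4 := by
    have := norm_sub_le u v
    nlinarith [norm_nonneg (u - v)]
  have h2 : ∑ k ∈ K, (ℓ k (u - v)) ^ 2 ≤ K.card * η ^ 2 := by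
    rw [← nsmul_eq_mul]
    refine Finset.sum_le_card_nsmul _ _ _ fun k hk => ?_
    have h3 := dist_le_pi_dist (P u) (P v) ⟨k, hk⟩
    have h4 : |ℓ k (u - v)| < η := by
      rw [map_sub, ← Real.dist_eq]
      exact h3.trans_lt hd'
    exact sq_le_sq' (abs_lt.mp h4).1.le (abs_lt.mp h4).2.le
  have h3 := hA (u - v)
  have h4 : ‖A (u - v)‖ ^ 2 < ε ^ 2 := by
    have h5 := mul_le_mul_of_nonneg_left h2 hc
    nlinarith [mul_le_mul_of_nonneg_left h1 (by positivity : 0 ≤ ε ^ 2 / 8)]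
  rw [Metric.mem_ball, dist_eq_norm]
  have := lt_of_pow_lt_pow_left₀ 2 hε.le h4
  rwa [map_sub] at this

variable {n : ℕ}

theorem norm_gradient (φ : E n → ℝ) (x : E n) : ‖gradient φ x‖ = ‖fderiv ℝ φ x‖ := by
  simp [gradient]

theorem continuous_gradient {φ : E n → ℝ} (hφ : ContDiff ℝ 1 φ) : Continuous (gradient φ) :=
  (InnerProductSpace.toDual ℝ (E n)).symm.continuous.comp (hφ.continuous_fderiv (by simp))

theorem sq_sub_le_integral {φ : E n → ℝ} (hφ : ContDiff ℝ 1 φ) (x z : E n) :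
    (φ (x + z) - φ x) ^ 2 ≤ ∫ t in (0 : ℝ)..1, (‖z‖ * ‖gradient φ (x + t • z)‖) ^ 2 := by
  set g : ℝ → ℝ := fun t => fderiv ℝ φ (x + t • z) z
  have hfc : Continuous (fderiv ℝ φ) := hφ.continuous_fderiv (by simp)
  have hgr := continuous_gradient hφ
  have hg : Continuous g := by fun_prop
  have hI : ∫ t in (0 : ℝ)..1, g t = φ (x + z) - φ x := by
    have hd : ∀ t ∈ Set.uIcc (0 : ℝ) 1, HasDerivAt (fun t : ℝ => φ (x + t • z)) (g t) t := by
      intro t _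
      have h1 : HasDerivAt (fun t : ℝ => x + t • z) z t := by
        simpa using ((hasDerivAt_id t).smul_const z).const_add x
      exact ((hφ.differentiable (by simp)) (x + t • z)).hasFDerivAt.comp_hasDerivAt t h1
    rw [intervalIntegral.integral_eq_sub_of_hasDerivAt hd (hg.intervalIntegrable _ _)]
    simp
  set c := φ (x + z) - φ x
  -- Since `c` is the mean of `g` on `[0, 1]`, nonnegativity of the variance is the Cauchy–Schwarz
  -- inequality needed.
  have h0 : 0 ≤ ∫ t in (0 : ℝ)..1, (g t - c) ^ 2 :=
    intervalIntegral.integral_nonneg zero_le_one fun t _ => sq_nonneg _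
  have h1 : ∫ t in (0 : ℝ)..1, (g t - c) ^ 2 = (∫ t in (0 : ℝ)..1, g t ^ 2) - c ^ 2 := by
    have : ∀ t, (g t - c) ^ 2 = g t ^ 2 - (2 * c) * g t + c ^ 2 := fun t => by ring
    simp only [this]
    rw [intervalIntegral.integral_add, intervalIntegral.integral_sub,
      intervalIntegral.integral_const_mul, hI, intervalIntegral.integral_const]
    · simp; ring
    all_goals exact Continuous.intervalIntegrable (by fun_prop) _ _
  have h2 : ∫ t in (0 : ℝ)..1, g t ^ 2 ≤
      ∫ t in (0 : ℝ)..1, (‖z‖ * ‖gradient φ (x + t • z)‖) ^ 2 := by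
    refine intervalIntegral.integral_mono_on zero_le_one
      (Continuous.intervalIntegrable (by fun_prop) _ _)
      (Continuous.intervalIntegrable (by fun_prop) _ _) fun t _ => ?_
    rw [norm_gradient, ← sq_abs (g t), mul_comm]
    gcongr
    exact (fderiv ℝ φ (x + t • z)).le_opNorm z
  linarith

/-- Translations of a `C¹` function in `L²`. -/
theorem lintegral_sq_sub_le {φ : E n → ℝ} (hφ : ContDiff ℝ 1 φ) (z : E n) :
    ∫⁻ x, ENNReal.ofReal ((φ x - φ (x + z)) ^ 2) ≤
      ENNReal.ofReal (‖z‖ ^ 2) * ∫⁻ x, ENNReal.ofReal (‖gradient φ x‖ ^ 2) := by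
  have hgr := continuous_gradient hφ
  have h1 : ∀ x, ENNReal.ofReal ((φ x - φ (x + z)) ^ 2) ≤ ∫⁻ t in Set.Ioc (0 : ℝ) 1,
      ENNReal.ofReal (‖z‖ ^ 2) * ENNReal.ofReal (‖gradient φ (x + t • z)‖ ^ 2) := by
    intro x
    have h2 := sq_sub_le_integral hφ x z
    have hint : IntegrableOn (fun t : ℝ => (‖z‖ * ‖gradient φ (x + t • z)‖) ^ 2)
        (Set.Ioc 0 1) volume :=
      (Continuous.integrableOn_Icc (by fun_prop)).mono_set Set.Ioc_subset_Icc_self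
    rw [intervalIntegral.integral_of_le zero_le_one] at h2
    calc _ = ENNReal.ofReal ((φ (x + z) - φ x) ^ 2) := by rw [sub_sq_comm]
      _ ≤ _ := ENNReal.ofReal_le_ofReal h2
      _ = _ := by
        rw [ofReal_integral_eq_lintegral_ofReal hint
          (Filter.Eventually.of_forall fun t => sq_nonneg _)]
        refine lintegral_congr fun t => ?_
        rw [mul_pow, ENNReal.ofReal_mul (sq_nonneg _)]
  refine (lintegral_mono h1).trans ?_
  rw [lintegral_lintegral_swap]
  · have h3 : ∀ t : ℝ, ∫⁻ x : E n, ENNReal.ofReal (‖z‖ ^ 2) *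
        ENNReal.ofReal (‖gradient φ (x + t • z)‖ ^ 2) =
        ENNReal.ofReal (‖z‖ ^ 2) * ∫⁻ x, ENNReal.ofReal (‖gradient φ x‖ ^ 2) := fun t => by
      rw [lintegral_const_mul' _ _ ENNReal.ofReal_ne_top,
        lintegral_add_right_eq_self (fun x => ENNReal.ofReal (‖gradient φ x‖ ^ 2)) (t • z)]
    simp only [h3]
    simp
  · refine AEMeasurable.const_mul (Continuous.aemeasurable ?_) _
    exact ENNReal.continuous_ofReal.comp (by fun_prop)

/-- The variance identity: expanding `(φ x - φ y) ^ 2` and integrating in both variables gives twice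
the left side. -/
theorem ofReal_mul_integral_sq_sub_sq_integral_le {α : Type*} [MeasurableSpace α] {μ : Measure α}
    [IsFiniteMeasure μ] {φ : α → ℝ} (hφ : MemLp φ 2 μ) :
    ENNReal.ofReal (μ.real Set.univ * ∫ x, φ x ^ 2 ∂μ - (∫ x, φ x ∂μ) ^ 2) ≤
      2⁻¹ * ∫⁻ x, ∫⁻ y, ENNReal.ofReal ((φ x - φ y) ^ 2) ∂μ ∂μ := by
  have h1 : Integrable φ μ := hφ.integrable (by norm_num)
  have h2 : Integrable (fun x => φ x ^ 2) μ := hφ.integrable_sq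
  set m := μ.real Set.univ
  set a := ∫ x, φ x ∂μ
  set s := ∫ x, φ x ^ 2 ∂μ
  have i1 : ∀ x, Integrable (fun y => φ x ^ 2 - 2 * φ x * φ y) μ := fun x =>
    (integrable_const _).sub (h1.const_mul _)
  have i2 : Integrable (fun x => m * φ x ^ 2 - 2 * φ x * a) μ :=
    (h2.const_mul _).sub ((h1.const_mul 2).mul_const a)
  have i3 : ∀ x, Integrable (fun y => (φ x - φ y) ^ 2) μ := fun x => by
    simp only [sub_sq]
    exact (i1 x).add h2
  have e0 : ∀ x, ∫ y, (φ x - φ y) ^ 2 ∂μ = m * φ x ^ 2 - 2 * φ x * a + s := fun x => by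
    simp only [sub_sq]
    rw [integral_add (i1 x) h2, integral_sub (integrable_const _) (h1.const_mul _),
      integral_const, integral_const_mul, smul_eq_mul]
  have hnn : ∀ x, 0 ≤ m * φ x ^ 2 - 2 * φ x * a + s := fun x => by
    rw [← e0]
    exact integral_nonneg fun y => sq_nonneg _
  have e1 : ∀ x, ∫⁻ y, ENNReal.ofReal ((φ x - φ y) ^ 2) ∂μ =
      ENNReal.ofReal (m * φ x ^ 2 - 2 * φ x * a + s) := fun x => by
    rw [← ofReal_integral_eq_lintegral_ofReal (i3 x)
      (Filter.Eventually.of_forall fun y => sq_nonneg _), e0]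
  have e2 : ∫ x, (m * φ x ^ 2 - 2 * φ x * a + s) ∂μ = m * s - 2 * a * a + m * s := by
    rw [integral_add i2 (integrable_const _), integral_sub (h2.const_mul _)
      ((h1.const_mul 2).mul_const a), integral_const_mul, integral_mul_const, integral_const_mul,
      integral_const, smul_eq_mul]
  have i4 : Integrable (fun x => m * φ x ^ 2 - 2 * φ x * a + s) μ := i2.add (integrable_const _)
  simp only [e1]
  rw [← ofReal_integral_eq_lintegral_ofReal i4 (Filter.Eventually.of_forall hnn), e2]
  change ENNReal.ofReal (m * s - a ^ 2) ≤ 2⁻¹ * ENNReal.ofReal (m * s - 2 * a * a + m * s)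
  have : m * s - 2 * a * a + m * s = 2 * (m * s - a ^ 2) := by ring
  rw [this, ENNReal.ofReal_mul (by norm_num), ← mul_assoc]
  simp [ENNReal.inv_mul_cancel]

/-- The half-open cube of side `ε` with lower corner `ε k`. -/
def cell (ε : ℝ) (k : Fin n → ℤ) : Set (E n) := {x | ∀ i, ⌊x i / ε⌋ = k i}

/-- The open cube of side `2 ε` centred at the origin. -/
def centredCube (ε : ℝ) : Set (E n) := {z | ∀ i, z i ∈ Set.Ioo (-ε) ε}

theorem measurableSet_cell (ε : ℝ) (k : Fin n → ℤ) : MeasurableSet (cell ε k) := by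
  have : cell ε k = ⋂ i, (fun x : E n => ⌊x i / ε⌋) ⁻¹' {k i} := by
    ext x; simp [cell]
  rw [this]
  refine MeasurableSet.iInter fun i => ?_
  have h : Measurable fun x : E n => x i / ε := Continuous.measurable (by fun_prop)
  exact h.floor (measurableSet_singleton _)

theorem measurableSet_centredCube (ε : ℝ) : MeasurableSet (centredCube ε : Set (E n)) := by
  have : (centredCube ε : Set (E n)) = ⋂ i, (fun x : E n => x i) ⁻¹' Set.Ioo (-ε) ε := by
    ext x; simp [centredCube]
  rw [this]
  refine MeasurableSet.iInter fun i => ?_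
  have h : Measurable fun x : E n => x i := Continuous.measurable (by fun_prop)
  exact h measurableSet_Ioo

theorem volume_cell {ε : ℝ} (hε : 0 < ε) (k : Fin n → ℤ) :
    volume (cell ε k) = ENNReal.ofReal ε ^ n := by
  have : cell ε k = WithLp.ofLp ⁻¹' (Set.univ.pi fun i => Set.Ico (ε * k i) (ε * (k i + 1))) := by
    ext x
    simp only [cell, Set.mem_ofPred_eq, Set.mem_preimage, Set.mem_univ_pi, Set.mem_Ico]
    refine forall_congr' fun i => ?_
    rw [Int.floor_eq_iff, le_div_iff₀' hε, div_lt_iff₀' hε]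
  rw [this, (PiLp.volume_preserving_ofLp (Fin n)).measure_preimage
    (MeasurableSet.univ_pi fun i => measurableSet_Ico).nullMeasurableSet, Real.volume_pi_Ico]
  simp [mul_add]

theorem volume_centredCube (ε : ℝ) :
    volume (centredCube ε : Set (E n)) = ENNReal.ofReal (2 * ε) ^ n := by
  have : (centredCube ε : Set (E n)) =
      WithLp.ofLp ⁻¹' (Set.univ.pi fun _ => Set.Ioo (-ε) ε) := by
    ext x
    simp [centredCube]
  rw [this, (PiLp.volume_preserving_ofLp (Fin n)).measure_preimage
    (MeasurableSet.univ_pi fun i => measurableSet_Ioo).nullMeasurableSet, Real.volume_pi_Ioo]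
  simp [two_mul]

theorem sub_mem_centredCube {ε : ℝ} (hε : 0 < ε) {k : Fin n → ℤ} {x y : E n}
    (hx : x ∈ cell ε k) (hy : y ∈ cell ε k) : y - x ∈ centredCube ε := by
  intro i
  have h := Int.abs_sub_lt_one_of_floor_eq_floor ((hy i).trans (hx i).symm)
  rw [← sub_div, abs_div, abs_of_pos hε, div_lt_one hε] at h
  simpa [abs_lt] using h

theorem norm_sq_le_of_mem_centredCube {ε : ℝ} {z : E n} (hz : z ∈ centredCube ε) :
    ‖z‖ ^ 2 ≤ n * ε ^ 2 := by
  rw [EuclideanSpace.norm_sq_eq]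
  calc ∑ i, ‖z i‖ ^ 2 ≤ ∑ _i : Fin n, ε ^ 2 := by
        refine Finset.sum_le_sum fun i _ => ?_
        rw [Real.norm_eq_abs, sq_abs]
        exact sq_le_sq' (hz i).1.le (hz i).2.le
    _ = n * ε ^ 2 := by simp

theorem disjoint_cell {ε : ℝ} {k l : Fin n → ℤ} (h : k ≠ l) : Disjoint (cell ε k) (cell ε l) :=
  Set.disjoint_left.mpr fun _ hx hx' => h (funext fun i => (hx i).symm.trans (hx' i))

/-- Substitute `y = x + z`: two points of one cell differ by a vector of the centred cube, and the
cells are disjoint in `x`. -/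
theorem sum_lintegral_cell_le {ε : ℝ} (hε : 0 < ε) (K : Finset (Fin n → ℤ))
    {G : E n → E n → ENNReal} (hG : Measurable (Function.uncurry G)) :
    ∑ k ∈ K, ∫⁻ x in cell ε k, ∫⁻ y in cell ε k, G x y ≤
      ∫⁻ z in centredCube ε, ∫⁻ x, G x (x + z) := by
  have h1 : ∀ k, ∀ x ∈ cell ε k,
      ∫⁻ y in cell ε k, G x y ≤ ∫⁻ z in centredCube ε, G x (x + z) := by
    intro k x hx
    rw [← lintegral_indicator (measurableSet_cell ε k),
      ← lintegral_indicator (measurableSet_centredCube ε),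
      ← lintegral_add_left_eq_self _ x]
    refine lintegral_mono fun z => ?_
    by_cases hz : x + z ∈ cell ε k
    · have hz' : z ∈ centredCube ε := by simpa using sub_mem_centredCube hε hx hz
      rw [Set.indicator_of_mem hz, Set.indicator_of_mem hz']
    · rw [Set.indicator_of_notMem hz]
      exact zero_le
  calc ∑ k ∈ K, ∫⁻ x in cell ε k, ∫⁻ y in cell ε k, G x y
      ≤ ∑ k ∈ K, ∫⁻ x in cell ε k, ∫⁻ z in centredCube ε, G x (x + z) :=
        Finset.sum_le_sum fun k _ => setLIntegral_mono' (measurableSet_cell ε k) (h1 k)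
    _ = ∫⁻ x in ⋃ k ∈ K, cell ε k, ∫⁻ z in centredCube ε, G x (x + z) :=
        (lintegral_biUnion_finset (fun k _ l _ h => disjoint_cell h)
          (fun k _ => measurableSet_cell ε k) _).symm
    _ ≤ ∫⁻ x, ∫⁻ z in centredCube ε, G x (x + z) := setLIntegral_le_lintegral _ _
    _ = _ := by
        rw [lintegral_lintegral_swap]
        refine Measurable.aemeasurable ?_
        exact hG.comp (f := fun p : E n × E n => (p.1, p.1 + p.2)) (by fun_prop)

/-- A Poincaré inequality summed over cells. The variance identity reduces it to translates by `z`
in the centred cube, with `‖z‖ ^ 2 ≤ n * ε ^ 2`; the factor `2 ^ n` is the ratio of the volumes of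
the centred cube and a cell. -/
theorem integral_sq_le_sum_cell {ε : ℝ} (hε : 0 < ε) {φ : E n → ℝ} (hφ : ContDiff ℝ 1 φ)
    (hc : HasCompactSupport φ) {K : Finset (Fin n → ℤ)}
    (hK : Function.support φ ⊆ ⋃ k ∈ K, cell ε k) :
    ∫ x, φ x ^ 2 ≤ (ε ^ n)⁻¹ * ∑ k ∈ K, (∫ x in cell ε k, φ x) ^ 2 +
      2 ^ n * n * ε ^ 2 * ∫ x, ‖gradient φ x‖ ^ 2 := by
  have hcont := hφ.continuous
  have hgr := continuous_gradient hφ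
  have hmem : MemLp φ 2 volume := hcont.memLp_of_hasCompactSupport hc
  have hgrc : HasCompactSupport fun x => ‖gradient φ x‖ ^ 2 := by
    refine (hc.fderiv (𝕜 := ℝ)).mono' fun x hx => subset_closure ?_
    intro h0
    apply hx
    simp only [norm_gradient, h0, norm_zero]
    norm_num
  have hgi : Integrable fun x => ‖gradient φ x‖ ^ 2 :=
    Continuous.integrable_of_hasCompactSupport (by fun_prop) hgrc
  have hfin : ∀ k : Fin n → ℤ, IsFiniteMeasure (volume.restrict (cell ε k)) := fun k =>
    isFiniteMeasure_restrict.mpr (by rw [volume_cell hε]; finiteness)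
  have hreal : ∀ k : Fin n → ℤ, (volume.restrict (cell ε k)).real Set.univ = ε ^ n := fun k => by
    rw [measureReal_def, Measure.restrict_apply_univ, volume_cell hε, ENNReal.toReal_pow,
      ENNReal.toReal_ofReal hε.le]
  have hsum : ∫ x, φ x ^ 2 = ∑ k ∈ K, ∫ x in cell ε k, φ x ^ 2 := by
    rw [← setIntegral_eq_integral_of_forall_compl_eq_zero (s := ⋃ k ∈ K, cell ε k)]
    · exact integral_biUnion_finset K (fun k _ => measurableSet_cell ε k)
        (fun k _ l _ h => disjoint_cell h) fun k _ => hmem.integrable_sq.integrableOn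
    · intro x hx
      have : φ x = 0 := by_contra fun h => hx (hK h)
      simp [this]
  have hD : ∫⁻ z in centredCube ε, ∫⁻ x, ENNReal.ofReal ((φ x - φ (x + z)) ^ 2) ≤
      ENNReal.ofReal ((2 * ε) ^ n * (n * ε ^ 2 * ∫ x, ‖gradient φ x‖ ^ 2)) := by
    have h1 : ∀ z ∈ centredCube ε, ∫⁻ x, ENNReal.ofReal ((φ x - φ (x + z)) ^ 2) ≤
        ENNReal.ofReal (n * ε ^ 2 * ∫ x, ‖gradient φ x‖ ^ 2) := fun z hz => by
      refine (lintegral_sq_sub_le hφ z).trans ?_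
      rw [ENNReal.ofReal_mul (by positivity), ofReal_integral_eq_lintegral_ofReal hgi
        (Filter.Eventually.of_forall fun x => sq_nonneg _)]
      gcongr
      exact norm_sq_le_of_mem_centredCube hz
    refine (setLIntegral_mono' (measurableSet_centredCube ε) h1).trans ?_
    rw [setLIntegral_const, volume_centredCube,
      ENNReal.ofReal_mul (p := (2 * ε) ^ n) (by positivity), ENNReal.ofReal_pow (by positivity),
      mul_comm]
  have hmeas : Measurable (Function.uncurry fun x y : E n => ENNReal.ofReal ((φ x - φ y) ^ 2)) :=
    (ENNReal.continuous_ofReal.comp (by fun_prop)).measurable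
  have hmain : ENNReal.ofReal (∑ k ∈ K,
      (ε ^ n * ∫ x in cell ε k, φ x ^ 2) - ∑ k ∈ K, (∫ x in cell ε k, φ x) ^ 2) ≤
      ENNReal.ofReal ((2 * ε) ^ n * (n * ε ^ 2 * ∫ x, ‖gradient φ x‖ ^ 2)) := by
    rw [← Finset.sum_sub_distrib]
    calc _ ≤ ∑ k ∈ K, ENNReal.ofReal
          (ε ^ n * (∫ x in cell ε k, φ x ^ 2) - (∫ x in cell ε k, φ x) ^ 2) :=
          Finset.le_sum_of_subadditive _ ENNReal.ofReal_zero.le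
            (fun _ _ => ENNReal.ofReal_add_le) _ _
      _ ≤ ∑ k ∈ K, ∫⁻ x in cell ε k, ∫⁻ y in cell ε k, ENNReal.ofReal ((φ x - φ y) ^ 2) := by
          refine Finset.sum_le_sum fun k _ => ?_
          have := ofReal_mul_integral_sq_sub_sq_integral_le (hmem.restrict (cell ε k))
          rw [hreal] at this
          refine this.trans (mul_le_of_le_one_left' ?_)
          exact ENNReal.inv_le_one.mpr one_le_two
      _ ≤ _ := (sum_lintegral_cell_le hε K hmeas).trans hD
  rw [ENNReal.ofReal_le_ofReal_iff (by positivity), ← Finset.mul_sum, ← hsum, mul_pow] at hmain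
  have hεn : 0 < ε ^ n := by positivity
  rw [← mul_le_mul_iff_right₀ hεn, mul_add, mul_inv_cancel_left₀ hεn.ne']
  linarith

theorem exists_finset_subset_cell {Ω : Set (E n)} (hΩ : Bornology.IsBounded Ω) (ε : ℝ)
    (hε : 0 < ε) : ∃ K : Finset (Fin n → ℤ), Ω ⊆ ⋃ k ∈ K, cell ε k := by
  obtain ⟨R, hR⟩ := hΩ.exists_norm_le
  refine ⟨Fintype.piFinset fun _ => Finset.Icc ⌊-R / ε⌋ ⌊R / ε⌋, fun x hx => ?_⟩
  refine Set.mem_iUnion₂.mpr ⟨fun i => ⌊x i / ε⌋, ?_, fun i => rfl⟩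
  refine Fintype.mem_piFinset.mpr fun i => Finset.mem_Icc.mpr ?_
  have h := abs_le.mp ((PiLp.norm_apply_le x i).trans (hR x hx))
  exact ⟨Int.floor_le_floor (by gcongr; exact h.1), Int.floor_le_floor (by gcongr; exact h.2)⟩

/-- The indicator function of a cell, as an element of `L²(Ω)`. -/
def cellIndicator (Ω : Set (E n)) {ε : ℝ} (hε : 0 < ε) (k : Fin n → ℤ) : L2 Ω :=
  indicatorConstLp 2 (measurableSet_cell ε k) (c := (1 : ℝ)) (by
    refine ((Measure.restrict_apply_le _ _).trans_lt ?_).ne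
    rw [volume_cell hε]
    finiteness)

theorem inner_cellIndicator {Ω : Set (E n)} {ε : ℝ} (hε : 0 < ε) (k : Fin n → ℤ) (u : L2 Ω) :
    inner ℝ (cellIndicator Ω hε k) u = ∫ x in cell ε k, u x ∂(volume.restrict Ω) :=
  L2.inner_indicatorConstLp_one _ _ _

theorem norm_sq_le_of_mem_testGraph {Ω : Set (E n)} {ε : ℝ} (hε : 0 < ε)
    {K : Finset (Fin n → ℤ)} (hK : Ω ⊆ ⋃ k ∈ K, cell ε k) {p : WithLp 2 (L2 Ω × L2Vec Ω)}
    (hp : p ∈ testGraph Ω) :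
    ‖p.fst‖ ^ 2 ≤ (ε ^ n)⁻¹ * ∑ k ∈ K, (inner ℝ (cellIndicator Ω hε k) p.fst) ^ 2 +
      2 ^ n * n * ε ^ 2 * ‖p.snd‖ ^ 2 := by
  obtain ⟨φ, ⟨hφ, hc, hs⟩, h1, h2⟩ := hp
  have hz : ∀ x, x ∉ Ω → φ x = 0 := fun x hx => image_eq_zero_of_notMem_tsupport fun h => hx (hs h)
  have hgz : ∀ x, x ∉ Ω → gradient φ x = 0 := fun x hx => by
    have : fderiv ℝ φ x = 0 := by
      by_contra h
      exact hx (hs (support_fderiv_subset ℝ h))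
    rw [gradient, this, map_zero]
  have e1 : ‖p.fst‖ ^ 2 = ∫ x, φ x ^ 2 := by
    rw [norm_sq_eq_integral, ← setIntegral_eq_integral_of_forall_compl_eq_zero (s := Ω)
      (f := fun x => φ x ^ 2) fun x hx => by rw [hz x hx]; norm_num]
    refine integral_congr_ae ?_
    filter_upwards [h1] with x hx
    rw [hx, sq]
  have e2 : ‖p.snd‖ ^ 2 = ∫ x, ‖gradient φ x‖ ^ 2 := by
    rw [← real_inner_self_eq_norm_sq, L2.inner_def,
      ← setIntegral_eq_integral_of_forall_compl_eq_zero (s := Ω)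
      (f := fun x => ‖gradient φ x‖ ^ 2) fun x hx => by rw [hgz x hx]; norm_num]
    refine integral_congr_ae ?_
    filter_upwards [h2] with x hx
    rw [hx, real_inner_self_eq_norm_sq]
  have e3 : ∀ k, inner ℝ (cellIndicator Ω hε k) p.fst = ∫ x in cell ε k, φ x := fun k => by
    rw [inner_cellIndicator, integral_congr_ae (ae_restrict_of_ae h1),
      Measure.restrict_restrict (measurableSet_cell ε k)]
    exact (setIntegral_eq_of_subset_of_forall_sdiff_eq_zero (measurableSet_cell ε k)
      Set.inter_subset_left fun x hx => hz x fun h => hx.2 ⟨hx.1, h⟩).symm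
  rw [e1, e2]
  simp only [e3]
  refine integral_sq_le_sum_cell hε (hφ.of_le (by simp)) hc fun x hx => hK ?_
  by_contra h
  exact hx (hz x h)

/-- **Rellich's theorem**: the embedding of `H¹₀(Ω)` into `L²(Ω)` is compact when `Ω` is
bounded. -/
theorem isCompactOperator_val {Ω : Set (E n)} (hΩ : Bornology.IsBounded Ω) :
    IsCompactOperator (val Ω) := by
  refine isCompactOperator_of_le_add_sum (κ := Fin n → ℤ) (val Ω) fun δ hδ => ?_
  obtain ⟨ε, hε, hεδ⟩ : ∃ ε > 0, 2 ^ n * n * ε ^ 2 < δ := by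
    have hcont : Continuous (fun ε : ℝ => 2 ^ n * n * ε ^ 2) := by fun_prop
    have h1 : Filter.Tendsto (fun ε : ℝ => 2 ^ n * n * ε ^ 2) (nhdsWithin 0 (Set.Ioi 0))
        (nhds 0) := (hcont.tendsto' 0 0 (by simp)).mono_left nhdsWithin_le_nhds
    obtain ⟨ε, h2, h3⟩ := ((h1.eventually_lt_const hδ).and self_mem_nhdsWithin).exists
    exact ⟨ε, h3, h2⟩
  obtain ⟨K, hK⟩ := exists_finset_subset_cell hΩ ε hε
  refine ⟨K, fun k => (innerSL ℝ (cellIndicator Ω hε k)).comp (val Ω), (ε ^ n)⁻¹,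
    by positivity, fun u => ?_⟩
  -- The estimate is a closed condition on pairs, so it extends from test functions to all of `H10
  -- Ω`.
  have hclosed : IsClosed {p : WithLp 2 (L2 Ω × L2Vec Ω) | ‖p.fst‖ ^ 2 ≤
      (ε ^ n)⁻¹ * ∑ k ∈ K, (inner ℝ (cellIndicator Ω hε k) p.fst) ^ 2 +
      2 ^ n * n * ε ^ 2 * ‖p.snd‖ ^ 2} := by
    have c1 : Continuous fun p : WithLp 2 (L2 Ω × L2Vec Ω) => p.fst :=
      (WithLp.fstL 2 ℝ (L2 Ω) (L2Vec Ω)).continuous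
    have c2 : Continuous fun p : WithLp 2 (L2 Ω × L2Vec Ω) => p.snd :=
      (WithLp.sndL 2 ℝ (L2 Ω) (L2Vec Ω)).continuous
    exact isClosed_le (by fun_prop) (by fun_prop)
  have hu : pair Ω u ∈ closure (testGraph Ω : Set (WithLp 2 (L2 Ω × L2Vec Ω))) := u.2
  have h := closure_minimal (fun p hp => norm_sq_le_of_mem_testGraph hε hK hp) hclosed hu
  change ‖val Ω u‖ ^ 2 ≤ (ε ^ n)⁻¹ * ∑ k ∈ K, (inner ℝ (cellIndicator Ω hε k) (val Ω u)) ^ 2 +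
      2 ^ n * n * ε ^ 2 * ‖grad Ω u‖ ^ 2 at h
  have hg : ‖grad Ω u‖ ^ 2 ≤ ‖u‖ ^ 2 := by
    have h3 : ‖u‖ ^ 2 = ‖val Ω u‖ ^ 2 + ‖grad Ω u‖ ^ 2 := by
      rw [← (pair Ω).norm_map u]
      exact WithLp.prod_norm_sq_eq_of_L2 (pair Ω u)
    rw [h3]
    linarith [sq_nonneg ‖val Ω u‖]
  have h4 := mul_le_mul hεδ.le hg (sq_nonneg _) hδ.le
  change _ ≤ _ + (ε ^ n)⁻¹ * ∑ k ∈ K, (inner ℝ (cellIndicator Ω hε k) (val Ω u)) ^ 2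
  linarith

/-! ### Translation of the problem into operators on `H10 Ω` -/

variable (Ω : Set (E n))

/-- The operator `(1 - Δ)⁻¹` on `H¹₀(Ω)`: the inner product of `resolventOp u` and `v` in
`H¹₀(Ω)` is the inner product of `u` and `v` in `L²(Ω)`. -/
def resolventOp : H10 Ω →L[ℝ] H10 Ω := (ContinuousLinearMap.adjoint (val Ω)).comp (val Ω)

theorem inner_resolventOp (u v : H10 Ω) :
    inner ℝ (resolventOp Ω u) v = inner ℝ (val Ω u) (val Ω v) :=
  ContinuousLinearMap.adjoint_inner_left (val Ω) v (val Ω u)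

theorem inner_resolventOp_self (u : H10 Ω) : inner ℝ (resolventOp Ω u) u = ‖val Ω u‖ ^ 2 := by
  rw [inner_resolventOp, real_inner_self_eq_norm_sq]

theorem resolventOp_isSymmetric : (resolventOp Ω : H10 Ω →ₗ[ℝ] H10 Ω).IsSymmetric := fun u v => by
  change inner ℝ (resolventOp Ω u) v = inner ℝ u (resolventOp Ω v)
  rw [← real_inner_comm u, inner_resolventOp, inner_resolventOp, real_inner_comm]

theorem isCompactOperator_resolventOp {Ω : Set (E n)} (hΩ : Bornology.IsBounded Ω) :
    IsCompactOperator (resolventOp Ω) :=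
  (isCompactOperator_val hΩ).clm_comp (ContinuousLinearMap.adjoint (val Ω))

theorem inner_H10 (u v : H10 Ω) :
    inner ℝ u v = inner ℝ (val Ω u) (val Ω v) + inner ℝ (grad Ω u) (grad Ω v) := by
  rw [← (pair Ω).inner_map_map u v]
  exact WithLp.prod_inner_apply (pair Ω u) (pair Ω v)

theorem riesz_symm_eq_iff {g : Hm1 Ω} {u : H10 Ω} :
    (riesz Ω).symm g = u ↔ ∀ ψ, g ψ = inner ℝ u ψ := by
  rw [LinearIsometryEquiv.symm_apply_eq]
  exact DFunLike.ext_iff (F := StrongDual ℝ (H10 Ω))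

theorem embL2_eq (g : L2 Ω) : embL2 Ω g = riesz Ω (ContinuousLinearMap.adjoint (val Ω) g) := by
  rw [← LinearIsometryEquiv.symm_apply_eq, riesz_symm_eq_iff]
  exact fun ψ => (ContinuousLinearMap.adjoint_inner_left (val Ω) ψ g).symm

theorem negLap_eq (u : H10 Ω) : negLap Ω u = riesz Ω (u - resolventOp Ω u) := by
  rw [← LinearIsometryEquiv.symm_apply_eq, riesz_symm_eq_iff]
  intro ψ
  rw [inner_sub_left, inner_resolventOp, inner_H10, add_sub_cancel_left]
  rfl

theorem isEigenfunction_iff {μ : ℝ} {φ : H10 Ω} :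
    IsEigenfunction Ω μ φ ↔ φ ≠ 0 ∧ φ = (1 + μ) • resolventOp Ω φ := by
  have h : embL2 Ω (val Ω φ) = riesz Ω (resolventOp Ω φ) := embL2_eq Ω _
  rw [IsEigenfunction, negLap_eq, h, ← map_smul, (riesz Ω).injective.eq_iff, sub_eq_iff_eq_add,
    add_smul, one_smul, add_comm]

/-- Pairing the eigenvalue equation with `φ` gives `‖φ‖ ^ 2 = (1 + μ) * ‖val Ω φ‖ ^ 2`. -/
theorem IsEigenfunction.one_add_pos {Ω : Set (E n)} {μ : ℝ} {φ : H10 Ω}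
    (h : IsEigenfunction Ω μ φ) : 0 < 1 + μ := by
  obtain ⟨h0, h1⟩ := (isEigenfunction_iff Ω).mp h
  have h2 : ‖φ‖ ^ 2 = (1 + μ) * ‖val Ω φ‖ ^ 2 := by
    rw [← inner_resolventOp_self, ← real_inner_smul_left, ← h1, real_inner_self_eq_norm_sq]
  have h3 : 0 < ‖φ‖ ^ 2 := by positivity
  rw [h2] at h3
  exact pos_of_mul_pos_left h3 (sq_nonneg _)

/-- Eigenvalues exceed `-1`, so only this part of `I` matters; this is what lets an interval
unbounded below be replaced by a bounded one. -/
theorem vertX_eq_eigenSum {I : Set ℝ} {a b : ℝ} (hI : ∀ t > -1, t ∈ I ↔ a ≤ t ∧ t ≤ b) :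
    vertX Ω I = eigenSum (resolventOp Ω) (band a b) := by
  refine le_antisymm (Submodule.span_le.mpr ?_) (iSup_le fun l φ hφ => ?_)
  · rintro φ ⟨μ, hμ, hφ⟩
    have hpos := hφ.one_add_pos
    have h1 := ((isEigenfunction_iff Ω).mp hφ).2
    obtain ⟨ha, hb⟩ := (hI μ (by linarith)).mp hμ
    refine eigenspace_le_eigenSum (resolventOp Ω) (l := (1 + μ)⁻¹) (S := band a b) ?_ ?_
    · refine ⟨inv_pos.mpr hpos, ?_, ?_⟩
      · rw [← div_eq_mul_inv, div_le_one hpos]; linarith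
      · rw [← div_eq_mul_inv, one_le_div hpos]; linarith
    · rw [Module.End.mem_eigenspace_iff]
      exact (eq_inv_smul_iff₀ hpos.ne').mpr h1.symm
  · by_cases h0 : φ = 0
    · rw [h0]; exact Submodule.zero_mem _
    obtain ⟨l, hl, ha, hb⟩ := l
    have h1 : resolventOp Ω φ = l • φ := Module.End.mem_eigenspace_iff.mp hφ
    have hl' : l * l⁻¹ = 1 := mul_inv_cancel₀ hl.ne'
    have hi : 0 < l⁻¹ := inv_pos.mpr hl
    refine Submodule.subset_span ⟨l⁻¹ - 1, (hI _ (by linarith)).mpr ⟨?_, ?_⟩, ?_⟩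
    · have := mul_le_mul_of_nonneg_right ha hi.le
      rw [mul_assoc, hl'] at this
      linarith
    · have := mul_le_mul_of_nonneg_right hb hi.le
      rw [mul_assoc, hl'] at this
      linarith
    · rw [isEigenfunction_iff]
      refine ⟨h0, ?_⟩
      rw [h1, smul_smul, add_sub_cancel, inv_mul_cancel₀ hl.ne', one_smul]

/-- On an eigenfunction, `embL2` after `val` is the Riesz map up to the nonzero factor `(1 + μ)⁻¹`,
so the spans agree. -/
theorem vertY_eq_map (I : Set ℝ) :
    vertY Ω I = (vertX Ω I).map ((riesz Ω).toLinearEquiv : H10 Ω →ₗ[ℝ] Hm1 Ω) := by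
  refine le_antisymm (Submodule.span_le.mpr ?_) ?_
  · rintro _ ⟨φ, ⟨μ, hμ, hφ⟩, rfl⟩
    have h1 := ((isEigenfunction_iff Ω).mp hφ).2
    refine ⟨resolventOp Ω φ, ?_, (embL2_eq Ω _).symm⟩
    rw [(eq_inv_smul_iff₀ hφ.one_add_pos.ne').mpr h1.symm]
    exact Submodule.smul_mem _ _ (Submodule.subset_span ⟨μ, hμ, hφ⟩)
  · rw [vertX, Submodule.map_span, Submodule.span_le]
    rintro _ ⟨φ, ⟨μ, hμ, hφ⟩, rfl⟩
    have h1 := ((isEigenfunction_iff Ω).mp hφ).2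
    have h2 : riesz Ω φ = (1 + μ) • embL2 Ω (val Ω φ) := by
      have h : embL2 Ω (val Ω φ) = riesz Ω (resolventOp Ω φ) := embL2_eq Ω _
      rw [h, ← map_smul, ← h1]
    change riesz Ω φ ∈ vertY Ω I
    rw [h2]
    exact Submodule.smul_mem _ _ (Submodule.subset_span ⟨φ, ⟨μ, hμ, hφ⟩, rfl⟩)

/-- The Riesz isomorphism restricted to the horizontal subspaces. -/
def rieszHor (I : Set ℝ) : horX Ω I ≃ₗᵢ[ℝ] horY Ω I where
  toLinearEquiv := (riesz Ω).toLinearEquiv.ofSubmodules (horX Ω I) (horY Ω I) (by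
    rw [horY, vertY_eq_map]
    exact Submodule.map_orthogonal_equiv _ (riesz Ω))
  norm_map' u := (riesz Ω).norm_map u

/-- The operator `h ↦ (1 - Δ)⁻¹ (g h)` on `H¹₀(Ω)`, for a bounded function `g`. -/
def potentialOp (g : E n → ℝ) (hg : AEStronglyMeasurable g (volume.restrict Ω)) (M : ℝ)
    (hM : ∀ x, |g x| ≤ M) : H10 Ω →L[ℝ] H10 Ω :=
  (ContinuousLinearMap.adjoint (val Ω)).comp ((mulOp g hg M hM).comp (val Ω))

theorem inner_potentialOp {g : E n → ℝ} {hg : AEStronglyMeasurable g (volume.restrict Ω)} {M : ℝ}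
    {hM : ∀ x, |g x| ≤ M} (u v : H10 Ω) :
    inner ℝ (potentialOp Ω g hg M hM u) v = inner ℝ (mulOp g hg M hM (val Ω u)) (val Ω v) :=
  ContinuousLinearMap.adjoint_inner_left (val Ω) v (mulOp g hg M hM (val Ω u))

theorem potentialOp_isSymmetric {g : E n → ℝ} {hg : AEStronglyMeasurable g (volume.restrict Ω)}
    {M : ℝ} {hM : ∀ x, |g x| ≤ M} :
    (potentialOp Ω g hg M hM : H10 Ω →ₗ[ℝ] H10 Ω).IsSymmetric := fun u v => by
  change inner ℝ (potentialOp Ω g hg M hM u) v = inner ℝ u (potentialOp Ω g hg M hM v)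
  rw [← real_inner_comm u, inner_potentialOp, inner_potentialOp, inner_mulOp_comm,
    real_inner_comm]

/-! ### The derivative of `F` and its uniform lower bound -/

variable {Ω}

theorem hasFDerivAt_F (hΩ : Bornology.IsBounded Ω) {f : ℝ → ℝ} (hf : IsNonlinearity f) {M : ℝ}
    (hM : ∀ y, |deriv f y| ≤ M) (u : H10 Ω)
    (hg : AEStronglyMeasurable (fun x => deriv f (val Ω u x)) (volume.restrict Ω)) :
    HasFDerivAt (F hΩ hf)
      (((riesz Ω).toContinuousLinearEquiv : H10 Ω →L[ℝ] Hm1 Ω).comp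
        (ContinuousLinearMap.id ℝ (H10 Ω) - resolventOp Ω -
          potentialOp Ω (fun x => deriv f (val Ω u x)) hg M fun _ => hM _)) u := by
  have hN := hasFDerivAt_superposition (isCompactOperator_val hΩ) hf.contDiff hM
    (N := fun u => (hf.memLp hΩ (val Ω u)).toLp) (fun u => MemLp.coeFn_toLp _) u
    (D := (mulOp (fun x => deriv f (val Ω u x)) hg M fun _ => hM _).comp (val Ω))
    (fun h => mulOp_ae (hg := hg) (hM := fun _ => hM _) (val Ω h))
  have hF : F hΩ hf = fun u => (riesz Ω).toContinuousLinearEquiv (u - resolventOp Ω u -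
      ContinuousLinearMap.adjoint (val Ω) ((hf.memLp hΩ (val Ω u)).toLp)) := by
    funext u
    rw [F, negLap_eq, embL2_eq, ← map_sub]
    rfl
  rw [hF]
  exact ((riesz Ω).toContinuousLinearEquiv : H10 Ω →L[ℝ] Hm1 Ω).hasFDerivAt.comp u
    (((hasFDerivAt_id u).sub (resolventOp Ω).hasFDerivAt).sub
      ((ContinuousLinearMap.adjoint (val Ω)).hasFDerivAt.comp u hN))

theorem exists_uniform_bound_fderiv (hΩ : Bornology.IsBounded Ω) {f : ℝ → ℝ}
    (hf : IsNonlinearity f) {a b : ℝ} (hfab : ∀ y, a ≤ deriv f y ∧ deriv f y ≤ b) {I : Set ℝ}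
    (hI : ∀ t > -1, t ∈ I ↔ a ≤ t ∧ t ≤ b) :
    ∃ C : ℝ, 0 < C ∧ ∀ (v : H10 Ω) (w : horX Ω I),
      DifferentiableAt ℝ (projRestr hΩ hf I v) w ∧
      (∀ h : horX Ω I, C * ‖h‖ ≤ ‖fderiv ℝ (projRestr hΩ hf I v) w h‖) ∧
      (fderiv ℝ (projRestr hΩ hf I v) w).IsInvertible := by
  obtain ⟨M, hM⟩ := hf.bounded
  -- Only `T`, `a` and `b` determine `c`; it is fixed before `v` and `w`, which enter only through
  -- `m`.
  obtain ⟨c, hc, hcoer⟩ := exists_uniform_reflected_coercive (isCompactOperator_resolventOp hΩ)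
    (resolventOp_isSymmetric Ω) (fun u => by rw [inner_resolventOp_self]; positivity)
    ((hfab 0).1.trans (hfab 0).2)
  rw [← vertX_eq_eigenSum Ω hI] at hcoer
  refine ⟨c, hc, fun v w => ?_⟩
  set u : H10 Ω := v + w
  have hg : AEStronglyMeasurable (fun x => deriv f (val Ω u x)) (volume.restrict Ω) :=
    (hf.contDiff.continuous_deriv (by simp)).comp_aestronglyMeasurable (Lp.aestronglyMeasurable _)
  set m := potentialOp Ω (fun x => deriv f (val Ω u x)) hg M fun _ => hM _
  set L : H10 Ω →L[ℝ] H10 Ω := ContinuousLinearMap.id ℝ (H10 Ω) - resolventOp Ω - m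
  have hL : ∀ h, L h = h - resolventOp Ω h - m h := fun h => rfl
  set D : horX Ω I →L[ℝ] horY Ω I := (horY Ω I).orthogonalProjectionOnto.comp
    ((((riesz Ω).toContinuousLinearEquiv : H10 Ω →L[ℝ] Hm1 Ω).comp L).comp (horX Ω I).subtypeL)
  have hD : HasFDerivAt (projRestr hΩ hf I v) D w := by
    have h1 : HasFDerivAt (fun w : horX Ω I => v + (w : H10 Ω)) (horX Ω I).subtypeL w :=
      (horX Ω I).subtypeL.hasFDerivAt.const_add v
    have h2 : HasFDerivAt (fun w : horX Ω I => F hΩ hf (v + w))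
        ((((riesz Ω).toContinuousLinearEquiv : H10 Ω →L[ℝ] Hm1 Ω).comp L).comp
          (horX Ω I).subtypeL) w :=
      HasFDerivAt.comp (g := F hΩ hf) w (hasFDerivAt_F hΩ hf hM u hg) h1
    exact ((horY Ω I).orthogonalProjectionOnto.hasFDerivAt).comp w h2
  -- The projection `Q` disappears when paired with elements of `horY`, which leaves the form of `L`
  -- on `horX`.
  have hDin : ∀ h k : horX Ω I, inner ℝ (D h) (rieszHor Ω I k) = inner ℝ (L h) (k : H10 Ω) := by
    intro h k
    refine (Submodule.inner_orthogonalProjectionOnto_eq_of_mem_right (rieszHor Ω I k)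
      (riesz Ω (L h))).trans ?_
    change inner ℝ ((riesz Ω).symm (riesz Ω (L h))) ((riesz Ω).symm (riesz Ω k)) = _
    rw [LinearIsometryEquiv.symm_apply_apply, LinearIsometryEquiv.symm_apply_apply]
  have hbound : ∀ h : horX Ω I, c * ‖h‖ ≤ ‖D h‖ := by
    intro h
    rcases eq_or_ne h 0 with rfl | hne
    · simp
    obtain ⟨y, hy, hyn, hyc⟩ := hcoer h h.2
    have h1 := hyc m (potentialOp_isSymmetric Ω)
      (fun z => by
        rw [inner_resolventOp_self, inner_potentialOp]
        exact le_inner_mulOp (fun x => (hfab _).1) _)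
      (fun z => by
        rw [inner_resolventOp_self, inner_potentialOp]
        exact inner_mulOp_le (fun x => (hfab _).2) _)
    rw [← hL, ← hDin h ⟨y, hy⟩] at h1
    have h2 := h1.trans (real_inner_le_norm _ _)
    have h3 : ‖rieszHor Ω I ⟨y, hy⟩‖ = ‖h‖ := by
      rw [LinearIsometryEquiv.norm_map]; exact hyn
    have h4 : c * ‖h‖ * ‖h‖ ≤ ‖D h‖ * ‖h‖ := by
      rw [h3] at h2
      calc c * ‖h‖ * ‖h‖ = c * ‖(h : H10 Ω)‖ ^ 2 := by rw [Submodule.coe_norm]; ring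
        _ ≤ _ := h2
    exact le_of_mul_le_mul_right h4 (norm_pos_iff.mpr hne)
  refine ⟨hD.differentiableAt, ?_, ?_⟩
  · rw [hD.fderiv]
    exact hbound
  · rw [hD.fderiv]
    set R := (rieszHor Ω I).toContinuousLinearEquiv
    -- Pulling `D` back by the Riesz isometry gives an endomorphism, for which symmetry makes sense.
    set A : horX Ω I →L[ℝ] horX Ω I := (R.symm : horY Ω I →L[ℝ] horX Ω I).comp D
    have hA : ∀ h k, inner ℝ (A h) k = inner ℝ (L h) (k : H10 Ω) := fun h k => by
      rw [← hDin, ← (rieszHor Ω I).inner_map_map]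
      congr 1
      exact (rieszHor Ω I).apply_symm_apply _
    have hAs : (A : horX Ω I →ₗ[ℝ] horX Ω I).IsSymmetric := fun h k => by
      change inner ℝ (A h) k = inner ℝ h (A k)
      rw [← real_inner_comm h, hA, hA, hL, hL]
      have e1 : inner ℝ (resolventOp Ω h) (k : H10 Ω) = inner ℝ (h : H10 Ω) (resolventOp Ω k) :=
        resolventOp_isSymmetric Ω h k
      have e2 : inner ℝ (m h) (k : H10 Ω) = inner ℝ (h : H10 Ω) (m k) :=
        potentialOp_isSymmetric Ω h k
      rw [real_inner_comm (h : H10 Ω)]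
      simp only [inner_sub_left, inner_sub_right, e1, e2]
    have hAi : A.IsInvertible := isInvertible_of_symmetric_of_bound hAs hc fun h => by
      have : ‖A h‖ = ‖D h‖ := (rieszHor Ω I).symm.norm_map _
      rw [this]
      exact hbound h
    have hDA : D = (R : horX Ω I →L[ℝ] horY Ω I).comp A := by
      ext h
      exact congrArg Subtype.val ((rieszHor Ω I).apply_symm_apply (D h)).symm
    rw [hDA]
    exact (ContinuousLinearMap.isInvertible_equiv (f := R)).comp hAi

end Semilinear

end

theorem proposition1 {n : ℕ} (hn : 1 ≤ n) (Ω : Set (Semilinear.E n)) (hΩo : IsOpen Ω)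
    (hΩ : Bornology.IsBounded Ω) (f : ℝ → ℝ) (hf : Semilinear.IsNonlinearity f)
    (a : EReal) (b : ℝ) (I : Set ℝ) (hI : I = {t : ℝ | a ≤ (t : EReal) ∧ t ≤ b})
    (hfI : closure (Set.range (deriv f)) ⊆ I) :
    ∃ C : ℝ, 0 < C ∧ ∀ v ∈ Semilinear.vertX Ω I, ∀ w : Semilinear.horX Ω I,
      DifferentiableAt ℝ (Semilinear.projRestr hΩ hf I v) w ∧
      (∀ h : Semilinear.horX Ω I,
        C * ‖h‖ ≤ ‖fderiv ℝ (Semilinear.projRestr hΩ hf I v) w h‖) ∧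
      (fderiv ℝ (Semilinear.projRestr hΩ hf I v) w).IsInvertible := by
  have hmem : ∀ y : ℝ, a ≤ ((deriv f y : ℝ) : EReal) ∧ deriv f y ≤ b := fun y => by
    have h := hfI (subset_closure (Set.mem_range_self y))
    rw [hI] at h
    exact h
  obtain ⟨a', hfab, hI'⟩ : ∃ a' : ℝ, (∀ y, a' ≤ deriv f y ∧ deriv f y ≤ b) ∧
      ∀ t > -1, t ∈ I ↔ a' ≤ t ∧ t ≤ b := by
    induction a using EReal.rec with
    | bot =>
      obtain ⟨M, hM⟩ := hf.bounded
      -- The term `-M` bounds `f'` from below; `-1` ensures that no `t > -1`, hence no eigenvalue,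
      -- is cut off.
      refine ⟨min (-M) (-1), fun y => ⟨?_, (hmem y).2⟩, fun t ht => ?_⟩
      · exact (min_le_left _ _).trans (abs_le.mp (hM y)).1
      · have : min (-M) (-1) ≤ t := (min_le_right _ _).trans ht.le
        simp [hI, this]
    | coe r =>
      refine ⟨r, fun y => ⟨EReal.coe_le_coe_iff.mp (hmem y).1, (hmem y).2⟩, fun t _ => ?_⟩
      simp [hI]
    | top => exact absurd (hmem 0).1 (by simp)
  obtain ⟨C, hC, h⟩ := Semilinear.exists_uniform_bound_fderiv hΩ hf hfab hI'
  exact ⟨C, hC, fun v _ => h v⟩
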